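/- \textbf{Setting.} Let $I=(0,1]$ and let $\rho=(\rho_\varepsilon)\in(0,1]^{I}$ be a gauge, i.e. $\rho_\varepsilon\to0$ as $\varepsilon\to0^+$; "for $\varepsilon$ small" means for all $\varepsilon\in(0,\varepsilon_0]$, for some $\varepsilon_0\in I$. A net $(x_\varepsilon)_{\varepsilon\in I}$ of real or complex numbers is moderate if $|x_\varepsilon|\le\rho_\varepsilon^{-N}$ for $\varepsilon$ small, for some $N\in\mathbb N$, and negligible if for every $m\in\mathbb N$, $|x_\varepsilon|\le\rho_\varepsilon^{m}$ for $\varepsilon$ small. The rings ${}^\rho\widetilde{\mathbb R}$ and ${}^\rho\widetilde{\mathbb C}$ consist of the classes $[x_\varepsilon]$ of moderate nets of real, resp. complex, numbers modulo negligible ones. Put $[x_\varepsilon]\le[y_\varepsilon]$ if $x_\varepsilon\le y_\varepsilon+z_\varepsilon$ for $\varepsilon$ small with $(z_\varepsilon)$ negligible, and $x<y$ if $x\le y$ and $x-y$ is invertible; let $|[x_\varepsilon]|=[|x_\varepsilon|]$ (Euclidean norm on ${}^\rho\widetilde{\mathbb R}^n$) and $\mathrm d\rho=[\rho_\varepsilon]$.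 The number $k$ is infinite if $|k|\ge r$ for all real $r>0$. The sharp topology on ${}^\rho\widetilde{\mathbb R}^n$ is generated by the balls $\{x:|x-c|<r\}$, $c\in{}^\rho\widetilde{\mathbb R}^n$, $r>0$ in ${}^\rho\widetilde{\mathbb R}$. For a net of sets $A_\varepsilon\subseteq\mathbb R^n$, $[A_\varepsilon]$ is the set of points having some representative $(x_\varepsilon)$ with $x_\varepsilon\in A_\varepsilon$ for $\varepsilon$ small, and $\langle A_\varepsilon\rangle$ is the set of points all of whose representatives satisfy this. A map $f:X\to{}^\rho\widetilde{\mathbb C}$, $X\subseteq{}^\rho\widetilde{\mathbb R}^n$, is a generalized smooth function, $f\in{}^\rho\mathcal{GC}^\infty(X)$, if there are open sets $\Omega_\varepsilon\subseteq\mathbb R^n$ and $f_\varepsilon\in C^\infty(\Omega_\varepsilon,\mathbb C)$ with $X\subseteq\langle\Omega_\varepsilon\rangle$, such that for all $x=[x_\varepsilon]\in X$ (and every representative) $f(x)=[f_\varepsilon(x_\varepsilon)]$ and $(\partial^\alpha f_\varepsilon(x_\varepsilon))$ is moderate for all $\alpha\in\mathbb N^n$. If $K=[K_\varepsilon]$ with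 $K_\varepsilon\subseteq\mathbb R^n$ compact and $\sup_{x\in K_\varepsilon}|x|\le\rho_\varepsilon^{-N}$ for $\varepsilon$ small, for some $N\in\mathbb N$, and if $f$ is represented on $K$, in the sense that $f([x_\varepsilon])=[f_\varepsilon(x_\varepsilon)]$ for all $[x_\varepsilon]\in K$ and every representative, by continuous maps $f_\varepsilon$ on open sets $\Omega_\varepsilon$ with $K\subseteq\langle\Omega_\varepsilon\rangle$, then \[\int_K f(x)\,\mathrm dx:=\lim_{m\to\infty}\Bigl[\int_{\{x\,:\,d(x,K_\varepsilon)\le\rho_\varepsilon^m\}}f_\varepsilon(x)\,\mathrm dx\Bigr]\] (limit in the sharp topology, $m\in\mathbb N$). For $k>0$, with $e^{i[t_\varepsilon]}:=[e^{it_\varepsilon}]$, put \[\mathcal F_k(f)(\omega):=\int_{[-k,k]^n}f(x)e^{-ix\cdot\omega}\,\mathrm dx,\qquad \mathcal F_k^{-1}(f)(x):=\frac1{(2\pi)^n}\int_{[-k,k]^n}f(\omega)e^{ix\cdot\omega}\,\mathrm d\omega .\] \textbf{Theorem (Fourier inversion).} Let $k\in{}^\rho\widetilde{\mathbb R}$ be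 a positive infinite number, $K=[-k,k]^n\subseteq X\subseteq{}^\rho\widetilde{\mathbb R}^n$, and $f\in{}^\rho\mathcal{GC}^\infty(X)$. Then for every point $y$ of the interior of $K$ in the sharp topology, \[\lim_{h\to+\infty}\mathcal F_h^{-1}\bigl(\mathcal F_k(f)\bigr)(y)=\lim_{h\to+\infty}\mathcal F_h\bigl(\mathcal F_k^{-1}(f)\bigr)(y)=f(y)\] in the sharp topology, where $\lim_{h\to+\infty}\Phi(h)=l$ means: for every $q\in\mathbb N$ there is $\bar h\in{}^\rho\widetilde{\mathbb R}$ such that $|\Phi(h)-l|\le\mathrm d\rho^{\,q}$ for all $h\in{}^\rho\widetilde{\mathbb R}$ with $h\ge\bar h$. -/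

import Mathlib

open Filter Topology MeasureTheory
open scoped ContDiff

noncomputable section

namespace RobinsonColombeau

/-! ## The ring of generalized numbers -/

/-- The index set `(0, 1]`. In its order, "for `ε` small", i.e. `∃ ε₀, ∀ ε ≤ ε₀, P ε`,
is `∀ᶠ ε in atBot, P ε`, and the limit `ε → 0⁺` is the limit along `atBot`. -/
abbrev Idx : Type := Set.Ioc (0 : ℝ) 1

/-- A gauge: a net `ρ ∈ (0, 1]^(0, 1]` with `ρ_ε → 0` as `ε → 0⁺`. -/
structure Gauge where
  toFun : Idx → ℝ
  pos : ∀ ε, 0 < toFun ε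
  le_one : ∀ ε, toFun ε ≤ 1
  tendsto_zero : Tendsto toFun atBot (𝓝 0)

instance : CoeFun Gauge fun _ => Idx → ℝ := ⟨Gauge.toFun⟩

/-- `ρ`-moderate nets. -/
def Moderate (ρ : Gauge) {E : Type*} [SeminormedAddCommGroup E] (x : Idx → E) : Prop :=
  ∃ N : ℕ, ∀ᶠ ε in atBot, ‖x ε‖ ≤ (ρ ε ^ N)⁻¹

/-- `ρ`-negligible nets. -/
def Negligible (ρ : Gauge) {E : Type*} [SeminormedAddCommGroup E] (x : Idx → E) : Prop :=
  ∀ m : ℕ, ∀ᶠ ε in atBot, ‖x ε‖ ≤ ρ ε ^ m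

variable {ρ : Gauge}

lemma Gauge.eventually_le (ρ : Gauge) {c : ℝ} (hc : 0 < c) : ∀ᶠ ε in atBot, ρ ε ≤ c :=
  (ρ.tendsto_zero.eventually_lt_const hc).mono fun _ h => h.le

lemma Moderate.of_le {E F : Type*} [SeminormedAddCommGroup E] [SeminormedAddCommGroup F]
    {x : Idx → E} {y : Idx → F} (hx : Moderate ρ x) (h : ∀ ε, ‖y ε‖ ≤ ‖x ε‖) : Moderate ρ y := by
  obtain ⟨N, hN⟩ := hx
  exact ⟨N, hN.mono fun ε hε => (h ε).trans hε⟩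

lemma Negligible.of_le {E F : Type*} [SeminormedAddCommGroup E] [SeminormedAddCommGroup F]
    {x : Idx → E} {y : Idx → F} (hx : Negligible ρ x) (h : ∀ ε, ‖y ε‖ ≤ ‖x ε‖) :
    Negligible ρ y :=
  fun m => (hx m).mono fun ε hε => (h ε).trans hε

lemma moderate_const {E : Type*} [SeminormedAddCommGroup E] (c : E) :
    Moderate ρ (fun _ => c) := by
  refine ⟨1, (ρ.eventually_le (c := (‖c‖ + 1)⁻¹) (by positivity)).mono fun ε hε => ?_⟩
  have h := (le_inv_comm₀ (ρ.pos ε) (by positivity)).1 hε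
  simp only [pow_one]
  linarith

lemma Moderate.add {E : Type*} [SeminormedAddCommGroup E] {x y : Idx → E}
    (hx : Moderate ρ x) (hy : Moderate ρ y) : Moderate ρ (fun ε => x ε + y ε) := by
  obtain ⟨N, hN⟩ := hx
  obtain ⟨M, hM⟩ := hy
  refine ⟨N + M + 1, ?_⟩
  filter_upwards [hN, hM, ρ.eventually_le (c := 2⁻¹) (by norm_num)] with ε h1 h2 h3
  have hp := ρ.pos ε
  have hi : ∀ k : ℕ, 1 ≤ (ρ ε ^ k)⁻¹ := fun k =>
    (one_le_inv₀ (by positivity)).2 (pow_le_one₀ hp.le (ρ.le_one ε))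
  have h4 : 2 ≤ (ρ ε)⁻¹ := (le_inv_comm₀ hp (by norm_num)).1 h3
  rw [pow_succ, pow_add, mul_inv, mul_inv]
  have := norm_add_le (x ε) (y ε)
  have hA := hi N
  have hB := hi M
  nlinarith [mul_nonneg (sub_nonneg.2 hA) (sub_nonneg.2 hB),
    mul_le_mul_of_nonneg_left h4 (by positivity : 0 ≤ (ρ ε ^ N)⁻¹ * (ρ ε ^ M)⁻¹),
    mul_le_mul_of_nonneg_left hA (by positivity : 0 ≤ (ρ ε ^ M)⁻¹),
    mul_le_mul_of_nonneg_left hB (by positivity : 0 ≤ (ρ ε ^ N)⁻¹)]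

lemma Negligible.add {E : Type*} [SeminormedAddCommGroup E] {x y : Idx → E}
    (hx : Negligible ρ x) (hy : Negligible ρ y) : Negligible ρ (fun ε => x ε + y ε) := by
  intro m
  filter_upwards [hx (m + 1), hy (m + 1), ρ.eventually_le (c := 2⁻¹) (by norm_num)]
    with ε h1 h2 h3
  have hp : 0 < ρ ε ^ m := pow_pos (ρ.pos ε) m
  rw [pow_succ] at h1 h2
  have := norm_add_le (x ε) (y ε)
  nlinarith [mul_le_mul_of_nonneg_left h3 hp.le]

lemma Moderate.mul {A : Type*} [NormedRing A] {x y : Idx → A}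
    (hx : Moderate ρ x) (hy : Moderate ρ y) : Moderate ρ (fun ε => x ε * y ε) := by
  obtain ⟨N, hN⟩ := hx
  obtain ⟨M, hM⟩ := hy
  refine ⟨N + M, ?_⟩
  filter_upwards [hN, hM] with ε h1 h2
  rw [pow_add, mul_inv]
  exact (norm_mul_le _ _).trans (mul_le_mul h1 h2 (norm_nonneg _) ((norm_nonneg _).trans h1))

lemma Moderate.mul_negligible {A : Type*} [NormedRing A] {x y : Idx → A}
    (hx : Moderate ρ x) (hy : Negligible ρ y) : Negligible ρ (fun ε => x ε * y ε) := by
  obtain ⟨N, hN⟩ := hx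
  intro m
  filter_upwards [hN, hy (N + m)] with ε h1 h2
  have hp : 0 < ρ ε ^ N := pow_pos (ρ.pos ε) N
  refine (norm_mul_le _ _).trans ((mul_le_mul h1 h2 (norm_nonneg _) (by positivity)).trans ?_)
  rw [pow_add, inv_mul_cancel_left₀ hp.ne']

/-- The algebra of `ρ`-moderate nets of real (`𝕜 = ℝ`) or complex (`𝕜 = ℂ`) numbers. -/
def moderateNets (ρ : Gauge) (𝕜 : Type*) [RCLike 𝕜] : Subalgebra ℝ (Idx → 𝕜) where
  carrier := {x | Moderate ρ x}
  mul_mem' := fun hx hy => Moderate.mul hx hy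
  add_mem' := fun hx hy => Moderate.add hx hy
  algebraMap_mem' := fun r => moderate_const (algebraMap ℝ 𝕜 r)

/-- The ideal of `ρ`-negligible nets. -/
def negligibleNets (ρ : Gauge) (𝕜 : Type*) [RCLike 𝕜] : Ideal (moderateNets ρ 𝕜) where
  carrier := {x | Negligible ρ (x : Idx → 𝕜)}
  add_mem' := fun hx hy => Negligible.add hx hy
  zero_mem' := fun m => Eventually.of_forall fun ε => by
    simpa using pow_nonneg (ρ.pos ε).le m
  smul_mem' := fun c _ hx => Moderate.mul_negligible c.2 hx

/-- Generalized numbers: `RC ρ ℝ` is the Robinson-Colombeau ring of generalized real numbers,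
`RC ρ ℂ` the ring of generalized complex numbers. -/
def RC (ρ : Gauge) (𝕜 : Type*) [RCLike 𝕜] : Type _ := moderateNets ρ 𝕜 ⧸ negligibleNets ρ 𝕜

instance (ρ : Gauge) (𝕜 : Type*) [RCLike 𝕜] : CommRing (RC ρ 𝕜) :=
  inferInstanceAs (CommRing (moderateNets ρ 𝕜 ⧸ negligibleNets ρ 𝕜))

instance (ρ : Gauge) (𝕜 : Type*) [RCLike 𝕜] : Algebra ℝ (RC ρ 𝕜) :=
  inferInstanceAs (Algebra ℝ (moderateNets ρ 𝕜 ⧸ negligibleNets ρ 𝕜))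

/-- The class `[x_ε]` of a moderate net. -/
def RC.mk {𝕜 : Type*} [RCLike 𝕜] (x : moderateNets ρ 𝕜) : RC ρ 𝕜 :=
  Ideal.Quotient.mk (negligibleNets ρ 𝕜) x

/-- The net `u` is (moderate and) a representative of `x`, i.e. `x = [u_ε]`. -/
def Represents {𝕜 : Type*} [RCLike 𝕜] (u : Idx → 𝕜) (x : RC ρ 𝕜) : Prop :=
  ∃ hu : u ∈ moderateNets ρ 𝕜, RC.mk ⟨u, hu⟩ = x

lemma exists_represents {𝕜 : Type*} [RCLike 𝕜] (x : RC ρ 𝕜) : ∃ u, Represents u x := by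
  obtain ⟨u, hu⟩ := Ideal.Quotient.mk_surjective x
  exact ⟨u.1, u.2, hu⟩

/-- A chosen representative of a generalized number. -/
def RC.rep {𝕜 : Type*} [RCLike 𝕜] (x : RC ρ 𝕜) : Idx → 𝕜 := (exists_represents x).choose

lemma RC.represents_rep {𝕜 : Type*} [RCLike 𝕜] (x : RC ρ 𝕜) : Represents x.rep x :=
  (exists_represents x).choose_spec

lemma Represents.moderate {𝕜 : Type*} [RCLike 𝕜] {u : Idx → 𝕜} {x : RC ρ 𝕜}
    (hu : Represents u x) : Moderate ρ u := hu.1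

lemma Represents.negligible_sub {𝕜 : Type*} [RCLike 𝕜] {u v : Idx → 𝕜} {x : RC ρ 𝕜}
    (hu : Represents u x) (hv : Represents v x) : Negligible ρ (fun ε => u ε - v ε) := by
  obtain ⟨hu, rfl⟩ := hu
  obtain ⟨hv, h⟩ := hv
  exact Ideal.Quotient.eq.1 h.symm

open Classical in
/-- The class `[u_ε]` of a net `u`; it is only meaningful if `u` is moderate. -/
def RC.ofNet (ρ : Gauge) {𝕜 : Type*} [RCLike 𝕜] (u : Idx → 𝕜) : RC ρ 𝕜 :=
  if hu : u ∈ moderateNets ρ 𝕜 then RC.mk ⟨u, hu⟩ else 0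

lemma represents_ofNet {𝕜 : Type*} [RCLike 𝕜] {u v : Idx → 𝕜} (hu : Moderate ρ u)
    (h : Negligible ρ (fun ε => v ε - u ε)) (hv : Moderate ρ v) :
    Represents v (RC.ofNet ρ u) := by
  have hu : u ∈ moderateNets ρ 𝕜 := hu
  refine ⟨hv, ?_⟩
  rw [RC.ofNet, dif_pos hu]
  exact Ideal.Quotient.eq.2 h

/-- `[x_ε] ≤ [y_ε]` iff `x_ε ≤ y_ε + z_ε` for `ε` small, for some negligible net `z`. -/
instance : LE (RC ρ ℝ) :=
  ⟨fun x y => ∃ u v z : Idx → ℝ, Represents u x ∧ Represents v y ∧ Negligible ρ z ∧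
    ∀ᶠ ε in atBot, u ε ≤ v ε + z ε⟩

/-- `x < y` means that `x ≤ y` and `x - y` is invertible. -/
instance : LT (RC ρ ℝ) := ⟨fun x y => x ≤ y ∧ IsUnit (x - y)⟩

/-- The absolute value `|[z_ε]| = [|z_ε|]`. -/
def RC.abs {𝕜 : Type*} [RCLike 𝕜] (z : RC ρ 𝕜) : RC ρ ℝ := RC.ofNet ρ fun ε => ‖z.rep ε‖

lemma Represents.abs {𝕜 : Type*} [RCLike 𝕜] {u : Idx → 𝕜} {z : RC ρ 𝕜} (hu : Represents u z) :
    Represents (fun ε => ‖u ε‖) z.abs :=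
  represents_ofNet (z.represents_rep.moderate.of_le fun ε => by simp)
    ((hu.negligible_sub z.represents_rep).of_le fun ε => abs_norm_sub_norm_le _ _)
    (hu.moderate.of_le fun ε => by simp)

/-- The infinitesimal `dρ = [ρ_ε]`. -/
def Gauge.d (ρ : Gauge) : RC ρ ℝ := RC.ofNet ρ ρ

lemma Gauge.represents_d (ρ : Gauge) : Represents ρ ρ.d := by
  have h : Moderate ρ ρ := by
    refine (moderate_const (1 : ℝ)).of_le fun ε => ?_
    simpa [abs_of_pos (ρ.pos ε)] using ρ.le_one ε
  exact represents_ofNet h (fun m => Eventually.of_forall fun ε => by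
    simpa using pow_nonneg (ρ.pos ε).le m) h

/-- `x` is infinite: `|x| ≥ r` for every standard real `r > 0`. -/
def RC.IsInfinite (x : RC ρ ℝ) : Prop := ∀ r : ℝ, 0 < r → algebraMap ℝ (RC ρ ℝ) r ≤ x.abs

/-- The complex exponential `e^{it} = [e^{i t_ε}]` of a generalized real number `t = [t_ε]`. -/
def RC.expI (t : RC ρ ℝ) : RC ρ ℂ := RC.ofNet ρ fun ε => Complex.exp (Complex.I * (t.rep ε : ℂ))

lemma Represents.expI {u : Idx → ℝ} {t : RC ρ ℝ} (hu : Represents u t) :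
    Represents (fun ε => Complex.exp (Complex.I * (u ε : ℂ))) t.expI := by
  have hm : ∀ v : Idx → ℝ, Moderate ρ fun ε => Complex.exp (Complex.I * (v ε : ℂ)) := fun v =>
    (moderate_const (1 : ℝ)).of_le fun ε => by rw [Complex.norm_exp_I_mul_ofReal]; simp
  refine represents_ofNet (hm _) ((hu.negligible_sub t.represents_rep).of_le fun ε => ?_) (hm _)
  have h : Complex.exp (Complex.I * (u ε : ℂ)) - Complex.exp (Complex.I * (t.rep ε : ℂ)) =
      Complex.exp (Complex.I * (t.rep ε : ℂ)) *
        (Complex.exp (Complex.I * ((u ε - t.rep ε : ℝ) : ℂ)) - 1) := by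
    rw [mul_sub, ← Complex.exp_add, mul_one]
    congr 2
    push_cast
    ring
  rw [h, norm_mul, Complex.norm_exp_I_mul_ofReal, one_mul]
  exact Real.norm_exp_I_mul_ofReal_sub_one_le

/-! ## Generalized points, the sharp topology, sets generated by nets -/

/-- Points of the module of `n`-tuples of generalized real numbers. -/
abbrev Pt (ρ : Gauge) (n : ℕ) : Type := Fin n → RC ρ ℝ

variable {n : ℕ}

/-- The net `u` of points of `ℝⁿ` is a (moderate) representative of `x`, i.e. `x = [u_ε]`. -/
def RepresentsPt (u : Idx → EuclideanSpace ℝ (Fin n)) (x : Pt ρ n) : Prop :=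
  ∀ i, Represents (fun ε => u ε i) (x i)

/-- A chosen representative of a generalized point. -/
def Pt.rep (x : Pt ρ n) : Idx → EuclideanSpace ℝ (Fin n) :=
  fun ε => WithLp.toLp 2 fun i => (x i).rep ε

lemma Pt.representsPt_rep (x : Pt ρ n) : RepresentsPt x.rep x :=
  fun i => (x i).represents_rep

/-- The generalized Euclidean norm `|[x_ε]| = [|x_ε|]`. -/
def Pt.norm (x : Pt ρ n) : RC ρ ℝ := RC.ofNet ρ fun ε => ‖x.rep ε‖

lemma norm_le_sum_coord (v : EuclideanSpace ℝ (Fin n)) : ‖v‖ ≤ ∑ i, ‖v i‖ := by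
  have h : v = ∑ i, EuclideanSpace.single i (v i) := by
    ext j
    simp
  calc ‖v‖ = ‖∑ i, EuclideanSpace.single i (v i)‖ := by rw [← h]
    _ ≤ ∑ i, ‖EuclideanSpace.single i (v i)‖ := norm_sum_le _ _
    _ = ∑ i, ‖v i‖ := by simp

lemma Moderate.sum {ι E : Type*} [SeminormedAddCommGroup E] (s : Finset ι) {x : ι → Idx → E}
    (hx : ∀ i ∈ s, Moderate ρ (x i)) : Moderate ρ (fun ε => ∑ i ∈ s, x i ε) := by
  classical
  induction s using Finset.induction_on with
  | empty => simpa using moderate_const (0 : E)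
  | insert a s ha ih =>
    simp only [Finset.sum_insert ha]
    exact (hx a (by simp)).add (ih fun i hi => hx i (by simp [hi]))

lemma Negligible.sum {ι E : Type*} [SeminormedAddCommGroup E] (s : Finset ι) {x : ι → Idx → E}
    (hx : ∀ i ∈ s, Negligible ρ (x i)) : Negligible ρ (fun ε => ∑ i ∈ s, x i ε) := by
  classical
  induction s using Finset.induction_on with
  | empty => exact fun m => Eventually.of_forall fun ε => by simpa using pow_nonneg (ρ.pos ε).le m
  | insert a s ha ih =>
    simp only [Finset.sum_insert ha]
    exact (hx a (by simp)).add (ih fun i hi => hx i (by simp [hi]))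

lemma moderate_of_coord {u : Idx → EuclideanSpace ℝ (Fin n)}
    (hu : ∀ i, Moderate ρ fun ε => u ε i) : Moderate ρ u :=
  (Moderate.sum Finset.univ fun i _ =>
    (hu i).of_le (y := fun ε => ‖u ε i‖) fun ε => by simp).of_le fun ε =>
      (norm_le_sum_coord (u ε)).trans (le_abs_self _)

lemma negligible_of_coord {u : Idx → EuclideanSpace ℝ (Fin n)}
    (hu : ∀ i, Negligible ρ fun ε => u ε i) : Negligible ρ u :=
  (Negligible.sum Finset.univ fun i _ =>
    (hu i).of_le (y := fun ε => ‖u ε i‖) fun ε => by simp).of_le fun ε =>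
      (norm_le_sum_coord (u ε)).trans (le_abs_self _)

lemma RepresentsPt.norm {u : Idx → EuclideanSpace ℝ (Fin n)} {x : Pt ρ n}
    (hu : RepresentsPt u x) : Represents (fun ε => ‖u ε‖) x.norm := by
  have hm : ∀ {v : Idx → EuclideanSpace ℝ (Fin n)}, RepresentsPt v x →
      Moderate ρ fun ε => ‖v ε‖ := fun hv =>
    (moderate_of_coord fun i => (hv i).moderate).of_le fun ε => by simp
  refine represents_ofNet (hm x.representsPt_rep) ?_ (hm hu)
  refine (negligible_of_coord (u := fun ε => u ε - x.rep ε) fun i => ?_).of_le fun ε =>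
    abs_norm_sub_norm_le _ _
  simpa using (hu i).negligible_sub (x.representsPt_rep i)

/-- The ball `B_r(c) = {x | |x - c| < r}`. -/
def sharpBall (c : Pt ρ n) (r : RC ρ ℝ) : Set (Pt ρ n) := {x | Pt.norm (x - c) < r}

/-- The sharp topology, generated by the balls with positive invertible radii. -/
abbrev sharpTopology (ρ : Gauge) (n : ℕ) : TopologicalSpace (Pt ρ n) :=
  TopologicalSpace.generateFrom {U | ∃ (c : Pt ρ n) (r : RC ρ ℝ), 0 < r ∧ U = sharpBall c r}

/-- The set of sharply interior points of `K`. -/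
def sharpInterior (K : Set (Pt ρ n)) : Set (Pt ρ n) := @interior _ (sharpTopology ρ n) K

/-- The internal set `[A_ε]`. -/
def internalSet (ρ : Gauge) (A : Idx → Set (EuclideanSpace ℝ (Fin n))) : Set (Pt ρ n) :=
  {x | ∃ u, RepresentsPt u x ∧ ∀ᶠ ε in atBot, u ε ∈ A ε}

/-- The strongly internal set `⟨A_ε⟩`. -/
def stronglyInternalSet (ρ : Gauge) (A : Idx → Set (EuclideanSpace ℝ (Fin n))) : Set (Pt ρ n) :=
  {x | ∀ u, RepresentsPt u x → ∀ᶠ ε in atBot, u ε ∈ A ε}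

/-- The cube `[-k, k]ⁿ`. -/
def cube (n : ℕ) (k : RC ρ ℝ) : Set (Pt ρ n) := {x | ∀ i, -k ≤ x i ∧ x i ≤ k}

/-! ## Generalized smooth functions -/

/-- The partial derivative `∂_{i_1} ⋯ ∂_{i_j} g` of a smooth function. -/
def partialDeriv {j : ℕ} (i : Fin j → Fin n) (g : EuclideanSpace ℝ (Fin n) → ℂ)
    (x : EuclideanSpace ℝ (Fin n)) : ℂ :=
  iteratedFDeriv ℝ j g x fun l => EuclideanSpace.single (i l) 1

/-- `f` restricts to a generalized smooth function on `X` with generalized complex values: there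
are open sets `Ω_ε ⊆ ℝⁿ` and a net `f_ε ∈ C^∞(Ω_ε, ℂ)` such that `X ⊆ ⟨Ω_ε⟩`,
`f([x_ε]) = [f_ε(x_ε)]` and all `(∂^α f_ε(x_ε))` are moderate, for all `[x_ε] ∈ X`.
The values of `f` outside `X` are irrelevant. -/
def IsGSF (X : Set (Pt ρ n)) (f : Pt ρ n → RC ρ ℂ) : Prop :=
  ∃ (Ω : Idx → Set (EuclideanSpace ℝ (Fin n))) (F : Idx → EuclideanSpace ℝ (Fin n) → ℂ),
    (∀ ε, IsOpen (Ω ε)) ∧ (∀ ε, ContDiffOn ℝ ∞ (F ε) (Ω ε)) ∧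
    X ⊆ stronglyInternalSet ρ Ω ∧
    (∀ x ∈ X, ∀ u, RepresentsPt u x → Represents (fun ε => F ε (u ε)) (f x)) ∧
    ∀ x ∈ X, ∀ u, RepresentsPt u x → ∀ (j : ℕ) (i : Fin j → Fin n),
      Moderate ρ fun ε => partialDeriv i (F ε) (u ε)

/-! ## Integration over functionally compact sets -/

/-- `K` is functionally compact with representative `(K_ε)`: `K = [K_ε]`, where `(K_ε)` is a
sharply bounded net of compact sets. -/
def IsCompactRep (K : Set (Pt ρ n)) (A : Idx → Set (EuclideanSpace ℝ (Fin n))) : Prop :=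
  K = internalSet ρ A ∧ (∀ ε, IsCompact (A ε)) ∧
    ∃ N : ℕ, ∀ᶠ ε in atBot, ∀ x ∈ A ε, ‖x‖ ≤ (ρ ε ^ N)⁻¹

/-- The net of continuous maps `f_ε : Ω_ε → ℂ` represents the generalized integrable function
`f` on `K`. Since `f([x_ε]) = [f_ε(x_ε)]` is required for all representatives, the value
`[f_ε(x_ε)]` exists and depends on the point `[x_ε] ∈ K` only. -/
def RepresentsIntegrable (K : Set (Pt ρ n)) (f : Pt ρ n → RC ρ ℂ)
    (F : Idx → EuclideanSpace ℝ (Fin n) → ℂ) : Prop :=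
  ∃ Ω : Idx → Set (EuclideanSpace ℝ (Fin n)),
    (∀ ε, IsOpen (Ω ε)) ∧ (∀ ε, ContinuousOn (F ε) (Ω ε)) ∧
    K ⊆ stronglyInternalSet ρ Ω ∧
    ∀ x ∈ K, ∀ u, RepresentsPt u x → Represents (fun ε => F ε (u ε)) (f x)

/-- `v` is the integral of `f` over `K`: the limit in the sharp topology, as `m → ∞`, of the
generalized numbers `[∫ f_ε]`, the integral over the closed `ρ_ε^m`-neighbourhood of `K_ε` with
respect to Lebesgue measure. -/
def IsIntegral (K : Set (Pt ρ n)) (f : Pt ρ n → RC ρ ℂ) (v : RC ρ ℂ) : Prop :=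
  ∃ (A : Idx → Set (EuclideanSpace ℝ (Fin n))) (F : Idx → EuclideanSpace ℝ (Fin n) → ℂ),
    IsCompactRep K A ∧ RepresentsIntegrable K f F ∧
    ∀ q : ℕ, ∃ M : ℕ, ∀ m ≥ M, ∃ w : RC ρ ℂ,
      Represents (fun ε => ∫ x in Metric.cthickening (ρ ε ^ m) (A ε), F ε x) w ∧
      (w - v).abs ≤ ρ.d ^ q

open Classical in
/-- The integral `∫_K f(x) dx`. -/
def integral (K : Set (Pt ρ n)) (f : Pt ρ n → RC ρ ℂ) : RC ρ ℂ :=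
  if h : ∃ v, IsIntegral K f v then h.choose else 0

/-! ## The hyperfinite Fourier transform -/

/-- The hyperfinite Fourier transform `F_k(f)(w) = ∫_{[-k,k]ⁿ} f(x) e^{-i x·w} dx`. -/
def hft (k : RC ρ ℝ) (f : Pt ρ n → RC ρ ℂ) (w : Pt ρ n) : RC ρ ℂ :=
  integral (cube n k) fun x => f x * RC.expI (-(x ⬝ᵥ w))

/-- The inverse hyperfinite Fourier transform
`F_k⁻¹(f)(x) = (2π)⁻ⁿ ∫_{[-k,k]ⁿ} f(w) e^{i x·w} dw`. -/
def invHft (k : RC ρ ℝ) (f : Pt ρ n → RC ρ ℂ) (x : Pt ρ n) : RC ρ ℂ :=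
  ((2 * Real.pi) ^ n)⁻¹ • integral (cube n k) fun w => f w * RC.expI (x ⬝ᵥ w)

/-- `lim_{h → +∞} Φ(h) = l` in the sharp topology. -/
def SharpLimAtTop (Φ : RC ρ ℝ → RC ρ ℂ) (l : RC ρ ℂ) : Prop :=
  ∀ q : ℕ, ∃ hbar : RC ρ ℝ, ∀ h : RC ρ ℝ, hbar ≤ h → (Φ h - l).abs ≤ ρ.d ^ q

end RobinsonColombeau

end

/-!
The proof is carried out on representatives. Let `F_ε` represent `f` and `k_ε` represent `k`.

The integral over `[-k, k]ⁿ` is `[∫_{[-k_ε, k_ε]ⁿ} F_ε]`, whichever representatives are used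
(`represents_integral_cube`). This rests on a diagonal argument (`eventually_forall_box`): a
property that holds eventually along every representative of every point of the cube holds
uniformly on a neighbourhood of the cubes `[-k_ε, k_ε]ⁿ` whose width is a power of `ρ_ε`. It turns
the pointwise hypotheses of moderateness and negligibility into uniform ones. Hence both iterated
transforms are represented by iterated partial Fourier integrals over cubes, the outer one over
`[-h_ε, h_ε]ⁿ`, and by Fubini's theorem these are integrals of `F_ε` over `[-k_ε, k_ε]ⁿ` against
the product of Dirichlet kernels `∏ sin (h_ε (x_i - y_i)) / (π (x_i - y_i))`
(`boxFourier_boxFourier`).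

It remains to prove a classical pointwise inversion theorem with a rate. In one variable, an
integration by parts against the sine integral, which tends to `π / 2` at the rate `1 / A`, gives
an error of order `C (1 / (h δ) + log (1 + 2 h k) / h)` for a function bounded by `C` together with
its derivative, at a point of distance `δ` to the boundary of `[-k, k]`. In several variables the
variables are replaced one at a time (`norm_integral_mul_prod_sub_le`); each step costs the
one-variable error times the `L¹` norms of the remaining kernels, which are of order
`log (1 + 2 h k)`. The total is at most a constant times `C (k + 1) / (δ √h)`
(`exists_rate_le`). Here `C`, `k` and, because `y` is a sharply interior point, `1 / δ` are bounded
by powers of `ρ_ε⁻¹` (`exists_pow_of_mem_sharpInterior`), so the error is at most `ρ_ε^q` as soon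
as `h` exceeds a suitable power of `dρ⁻¹`.
-/

namespace DirichletKernel

open Set Real

/-! ### The Dirichlet kernel on the line -/

lemma integral_exp_neg_mul_sin (s A : ℝ) :
    ∫ t in (0 : ℝ)..A, exp (-(t * s)) * sin t =
      (1 + s ^ 2)⁻¹ * (1 - exp (-(A * s)) * (cos A + s * sin A)) := by
  have hs : (1 + s ^ 2) ≠ 0 := by positivity
  have h : ∀ t ∈ uIcc 0 A, HasDerivAt
      (fun t => -((1 + s ^ 2)⁻¹ * (exp (-(t * s)) * (cos t + s * sin t))))
      (exp (-(t * s)) * sin t) t := by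
    intro t _
    have h1 : HasDerivAt (fun t => exp (-(t * s))) (exp (-(t * s)) * (-s)) t := by
      simpa using! ((hasDerivAt_id t).mul_const s).neg.exp
    have h2 : HasDerivAt (fun t => cos t + s * sin t) (-sin t + s * cos t) t :=
      (hasDerivAt_cos t).add ((hasDerivAt_sin t).const_mul s)
    convert! ((h1.mul h2).const_mul ((1 + s ^ 2)⁻¹)).neg using 1
    field_simp
    ring
  rw [intervalIntegral.integral_eq_sub_of_hasDerivAt h
    (Continuous.intervalIntegrable (by fun_prop) _ _)]
  simp
  ring

lemma integral_exp_neg_mul_mul_sin {t : ℝ} (ht : 0 < t) :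
    ∫ s in Ioi (0 : ℝ), exp (-(t * s)) * sin t = sinc t := by
  rw [integral_mul_const]
  have := integral_exp_mul_Ioi (a := -t) (by linarith) 0
  simp only [neg_mul] at this
  rw [this, sinc_of_ne_zero ht.ne']
  simp
  field_simp

lemma integrableOn_exp_neg_mul_Ioi {t : ℝ} (ht : 0 < t) :
    IntegrableOn (fun s => exp (-(t * s))) (Ioi 0) := by
  simpa using integrableOn_exp_mul_Ioi (a := -t) (by linarith) 0

lemma abs_cos_add_mul_sin_le (s A : ℝ) : |cos A + s * sin A| ≤ 1 + s ^ 2 := by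
  apply abs_le_of_sq_le_sq _ (by positivity)
  nlinarith [sin_sq_add_cos_sq A, sq_nonneg (s * cos A - sin A), sq_nonneg s, sq_nonneg (s ^ 2)]

/-- The sine integral tends to `π / 2` at the rate `1 / A`: write `sin t / t` as the Laplace
integral `∫₀^∞ e^{-ts} sin t ds` and integrate in `t` first. -/
lemma abs_integral_sinc_sub_le_inv {A : ℝ} (hA : 0 < A) :
    |(∫ t in (0 : ℝ)..A, sinc t) - π / 2| ≤ A⁻¹ := by
  have hint : Integrable (Function.uncurry fun t s : ℝ => exp (-(t * s)) * sin t)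
      ((volume.restrict (Ioc 0 A)).prod (volume.restrict (Ioi 0))) := by
    have hc : Continuous (Function.uncurry fun t s : ℝ => exp (-(t * s)) * sin t) := by
      unfold Function.uncurry
      fun_prop
    refine (integrable_prod_iff hc.aestronglyMeasurable).2 ⟨?_, ?_⟩
    · filter_upwards [ae_restrict_mem measurableSet_Ioc] with t ht
      exact (integrableOn_exp_neg_mul_Ioi ht.1).mul_const (sin t)
    · have : IntegrableOn (fun t => |sinc t|) (Ioc 0 A) :=
        (continuous_sinc.abs.integrableOn_Icc (a := 0) (b := A)).mono_set Ioc_subset_Icc_self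
      refine this.congr_fun (fun t ht => ?_) measurableSet_Ioc
      simp only [Function.uncurry, norm_mul, norm_eq_abs, abs_exp]
      rw [integral_mul_const]
      have h := integral_exp_neg_mul_mul_sin ht.1
      rw [integral_mul_const] at h
      rw [← h, abs_mul, abs_of_nonneg (integral_nonneg fun s => (exp_pos _).le)]
  have key : ∫ t in (0 : ℝ)..A, sinc t =
      ∫ s in Ioi (0 : ℝ), (1 + s ^ 2)⁻¹ * (1 - exp (-(A * s)) * (cos A + s * sin A)) := by
    rw [intervalIntegral.integral_of_le hA.le]
    calc _ = ∫ t in Ioc 0 A, ∫ s in Ioi (0 : ℝ), exp (-(t * s)) * sin t :=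
          setIntegral_congr_fun measurableSet_Ioc fun t ht =>
            (integral_exp_neg_mul_mul_sin ht.1).symm
      _ = ∫ s in Ioi (0 : ℝ), ∫ t in Ioc 0 A, exp (-(t * s)) * sin t :=
          integral_integral_swap hint
      _ = _ := by
          refine integral_congr_ae (Eventually.of_forall fun s => ?_)
          simp only
          rw [← integral_exp_neg_mul_sin, intervalIntegral.integral_of_le hA.le]
  have hb : ∀ s : ℝ, ‖(1 + s ^ 2)⁻¹ * (exp (-(A * s)) * (cos A + s * sin A))‖ ≤
      exp (-(A * s)) := fun s => by
    rw [norm_mul, norm_mul, norm_inv, norm_eq_abs, norm_eq_abs, norm_eq_abs, abs_exp,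
      abs_of_pos (by positivity : (0 : ℝ) < 1 + s ^ 2)]
    rw [inv_mul_le_iff₀ (by positivity), mul_comm]
    exact mul_le_mul_of_nonneg_right (abs_cos_add_mul_sin_le s A) (exp_pos _).le
  have hi : IntegrableOn (fun s => (1 + s ^ 2)⁻¹ * (exp (-(A * s)) * (cos A + s * sin A)))
      (Ioi 0) :=
    (integrableOn_exp_neg_mul_Ioi hA).mono'
      (Continuous.aestronglyMeasurable (by
        have : ∀ s : ℝ, 1 + s ^ 2 ≠ 0 := fun s => by positivity
        fun_prop (disch := assumption)))
      (Eventually.of_forall hb)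
  have h2 : ∫ t in (0 : ℝ)..A, sinc t = π / 2 -
      ∫ s in Ioi (0 : ℝ), (1 + s ^ 2)⁻¹ * (exp (-(A * s)) * (cos A + s * sin A)) := by
    rw [key]
    simp only [mul_sub, mul_one]
    rw [integral_sub integrable_inv_one_add_sq.integrableOn hi, integral_Ioi_inv_one_add_sq]
    simp
  rw [h2, sub_sub_cancel_left, abs_neg]
  refine (norm_integral_le_of_norm_le (integrableOn_exp_neg_mul_Ioi hA)
    (Eventually.of_forall hb)).trans_eq ?_
  have := integral_exp_mul_Ioi (a := -A) (by linarith) 0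
  simp only [neg_mul] at this
  rw [this]
  simp

lemma abs_integral_sinc_sub_le {A : ℝ} (hA : 0 ≤ A) :
    |(∫ t in (0 : ℝ)..A, sinc t) - π / 2| ≤ 6 / (1 + A) := by
  rw [le_div_iff₀ (by positivity)]
  rcases le_total A 1 with h | h
  · have h1 : ‖∫ t in (0 : ℝ)..A, sinc t‖ ≤ 1 * |A - 0| :=
      intervalIntegral.norm_integral_le_of_norm_le_const fun t _ => abs_sinc_le_one t
    rw [sub_zero, abs_of_nonneg hA, norm_eq_abs, abs_le] at h1
    have h2 : |(∫ t in (0 : ℝ)..A, sinc t) - π / 2| ≤ 3 := by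
      rw [abs_le]
      constructor <;> linarith [pi_le_four, pi_pos, h1.1, h1.2]
    nlinarith [abs_nonneg ((∫ t in (0 : ℝ)..A, sinc t) - π / 2)]
  · have h1 := abs_integral_sinc_sub_le_inv (by linarith : 0 < A)
    have h2 : A⁻¹ * (1 + A) ≤ 2 := by
      rw [inv_mul_le_iff₀ (by linarith)]
      linarith
    nlinarith

/-- The Dirichlet kernel `sin (h t) / (π t) = (2π)⁻¹ ∫_{-h}^h e^{iwt} dw` of the line. -/
noncomputable def dirichletKernel (h t : ℝ) : ℝ := h / π * sinc (h * t)

@[fun_prop]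
lemma continuous_dirichletKernel (h : ℝ) : Continuous (dirichletKernel h) := by
  unfold dirichletKernel
  fun_prop

lemma dirichletKernel_neg (h t : ℝ) : dirichletKernel h (-t) = dirichletKernel h t := by
  simp [dirichletKernel]

lemma abs_sinc_le (u : ℝ) : |sinc u| ≤ 2 / (1 + |u|) := by
  rw [le_div_iff₀ (by positivity)]
  have h1 := abs_sinc_le_one u
  have h2 : |sinc u| * |u| ≤ 1 := by
    rcases eq_or_ne u 0 with rfl | hu
    · simp
    · rw [← abs_mul, sinc_of_ne_zero hu, div_mul_cancel₀ _ hu]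
      exact abs_sin_le_one u
  linarith

lemma integral_div_one_add_mul {h a : ℝ} (hh : 0 < h) (ha : 0 ≤ a) :
    ∫ t in (0 : ℝ)..a, 1 / (1 + h * t) = log (1 + h * a) / h := by
  have hpos : ∀ t ∈ uIcc 0 a, 0 < 1 + h * t := fun t ht => by
    rw [uIcc_of_le ha] at ht
    have := mul_nonneg hh.le ht.1
    linarith
  have hd : ∀ t ∈ uIcc 0 a, HasDerivAt (fun t => log (1 + h * t) / h) (1 / (1 + h * t)) t := by
    intro t ht
    have h1 : HasDerivAt (fun t => 1 + h * t) h t := by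
      simpa using! ((hasDerivAt_id t).const_mul h).const_add 1
    convert! (h1.log (hpos t ht).ne').div_const h using 1
    field_simp
  rw [intervalIntegral.integral_eq_sub_of_hasDerivAt hd]
  · simp
  · refine ContinuousOn.intervalIntegrable fun t ht => ?_
    have := (hpos t ht).ne'
    exact ContinuousAt.continuousWithinAt (by fun_prop (disch := assumption))

lemma intervalIntegrable_div_one_add_mul {h a : ℝ} (hh : 0 < h) (ha : 0 ≤ a) :
    IntervalIntegrable (fun t => 1 / (1 + h * t)) volume 0 a := by
  refine ContinuousOn.intervalIntegrable fun t ht => ?_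
  rw [uIcc_of_le ha] at ht
  have : 1 + h * t ≠ 0 := by
    have := mul_nonneg hh.le ht.1
    positivity
  exact ContinuousAt.continuousWithinAt (by fun_prop (disch := assumption))

lemma integral_abs_dirichletKernel_le {h a : ℝ} (hh : 0 < h) (ha : 0 ≤ a) :
    ∫ t in (0 : ℝ)..a, |dirichletKernel h t| ≤ log (1 + h * a) := by
  have hmono : ∫ t in (0 : ℝ)..a, |dirichletKernel h t| ≤
      ∫ t in (0 : ℝ)..a, h * (1 / (1 + h * t)) := by
    refine intervalIntegral.integral_mono_on ha
      (Continuous.intervalIntegrable (by fun_prop) _ _)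
      ((intervalIntegrable_div_one_add_mul hh ha).const_mul _) fun t ht => ?_
    have ht0 : 0 ≤ h * t := mul_nonneg hh.le ht.1
    have hs := abs_sinc_le (h * t)
    rw [abs_of_nonneg ht0] at hs
    rw [dirichletKernel, abs_mul, abs_of_pos (div_pos hh pi_pos), div_mul_eq_mul_div,
      div_le_iff₀ pi_pos, mul_assoc]
    refine mul_le_mul_of_nonneg_left (hs.trans ?_) hh.le
    rw [div_mul_eq_mul_div, one_mul]
    gcongr
    exact two_le_pi
  refine hmono.trans_eq ?_
  rw [intervalIntegral.integral_const_mul, integral_div_one_add_mul hh ha]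
  field_simp

/-- One half of the pointwise Fourier inversion theorem on an interval, for functions that are
continuously differentiable up to the boundary; the rate is explicit. -/
lemma norm_integral_mul_dirichletKernel_sub_le {g g' : ℝ → ℂ} {h a C : ℝ} (hh : 0 < h)
    (ha : 0 ≤ a) (hg : ∀ t ∈ Icc 0 a, HasDerivAt g (g' t) t) (hg' : ContinuousOn g' (Icc 0 a))
    (hC : ∀ t ∈ Icc 0 a, ‖g t‖ ≤ C) (hC' : ∀ t ∈ Icc 0 a, ‖g' t‖ ≤ C) :
    ‖(∫ t in (0 : ℝ)..a, g t * dirichletKernel h t) - g 0 / 2‖ ≤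
      2 * C * ((1 + h * a)⁻¹ + log (1 + h * a) / h) := by
  -- `v` is the primitive of the kernel that vanishes at infinity
  set v : ℝ → ℝ := fun t => (∫ u in (0 : ℝ)..(h * t), sinc u) / π - 1 / 2 with hv
  have hvd : ∀ t, HasDerivAt v (dirichletKernel h t) t := by
    intro t
    have h1 : HasDerivAt (fun x => ∫ u in (0 : ℝ)..x, sinc u) (sinc (h * t)) (h * t) :=
      intervalIntegral.integral_hasDerivAt_right (continuous_sinc.intervalIntegrable _ _)
        continuous_sinc.stronglyMeasurable.stronglyMeasurableAtFilter
        continuous_sinc.continuousAt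
    have h2 : HasDerivAt (fun t : ℝ => h * t) h t := by
      simpa using! (hasDerivAt_id t).const_mul h
    convert! ((h1.comp t h2).div_const π).sub_const (1 / 2) using 1
    rw [dirichletKernel]
    ring
  have hvb : ∀ t, 0 ≤ t → ‖(v t : ℂ)‖ ≤ 2 * (1 / (1 + h * t)) := by
    intro t ht
    have ht0 : 0 ≤ h * t := mul_nonneg hh.le ht
    have h1 := abs_integral_sinc_sub_le ht0
    have h2 : v t = ((∫ u in (0 : ℝ)..(h * t), sinc u) - π / 2) / π := by
      rw [hv]
      field_simp
    rw [Complex.norm_real, norm_eq_abs, h2, abs_div, abs_of_pos pi_pos, div_le_iff₀ pi_pos]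
    refine h1.trans ?_
    rw [mul_one_div, div_mul_eq_mul_div]
    gcongr
    linarith [pi_gt_three]
  have hv0 : v 0 = -1 / 2 := by
    rw [hv]
    norm_num
  have hC0 : 0 ≤ C := (norm_nonneg _).trans (hC 0 ⟨le_rfl, ha⟩)
  have hparts := intervalIntegral.integral_mul_deriv_eq_deriv_mul (a := 0) (b := a)
    (u := g) (v := fun t => (v t : ℂ)) (u' := g') (v' := fun t => (dirichletKernel h t : ℂ))
    (by rwa [uIcc_of_le ha]) (fun t _ => (hvd t).ofReal_comp)
    (ContinuousOn.intervalIntegrable (by rwa [uIcc_of_le ha]))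
    (Continuous.intervalIntegrable (by fun_prop) _ _)
  rw [hparts, hv0]
  have h1 : ‖g a * (v a : ℂ)‖ ≤ 2 * C * (1 + h * a)⁻¹ := by
    rw [norm_mul]
    refine (mul_le_mul (hC a ⟨ha, le_rfl⟩) (hvb a ha) (norm_nonneg _) hC0).trans_eq ?_
    ring
  have h2 : ‖∫ t in (0 : ℝ)..a, g' t * (v t : ℂ)‖ ≤ 2 * C * (log (1 + h * a) / h) := by
    rw [← integral_div_one_add_mul hh ha, ← intervalIntegral.integral_const_mul]
    refine intervalIntegral.norm_integral_le_of_norm_le ha (Eventually.of_forall fun t ht => ?_)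
      ((intervalIntegrable_div_one_add_mul hh ha).const_mul _)
    rw [norm_mul]
    refine (mul_le_mul (hC' t ⟨ht.1.le, ht.2⟩) (hvb t ht.1.le) (norm_nonneg _) hC0).trans_eq ?_
    ring
  have h3 : g a * (v a : ℂ) - g 0 * ((-1 / 2 : ℝ) : ℂ) - (∫ t in (0 : ℝ)..a, g' t * (v t : ℂ)) -
      g 0 / 2 = g a * (v a : ℂ) - ∫ t in (0 : ℝ)..a, g' t * (v t : ℂ) := by
    push_cast
    ring
  rw [h3]
  refine (norm_sub_le _ _).trans ?_
  linarith

/-- Pointwise Fourier inversion on `[-k, k]` with an explicit rate, for functions that are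
continuously differentiable up to the boundary. -/
lemma norm_integral_mul_dirichletKernel_sub_le_of_interior {g g' : ℝ → ℂ} {h k y δ C : ℝ}
    (hh : 0 < h) (hδ : 0 ≤ δ) (hy : |y| + δ ≤ k)
    (hg : ∀ t ∈ Icc (-k) k, HasDerivAt g (g' t) t) (hg' : ContinuousOn g' (Icc (-k) k))
    (hC : ∀ t ∈ Icc (-k) k, ‖g t‖ ≤ C) (hC' : ∀ t ∈ Icc (-k) k, ‖g' t‖ ≤ C) :
    ‖(∫ t in (-k)..k, g t * dirichletKernel h (t - y)) - g y‖ ≤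
      4 * C * ((1 + h * δ)⁻¹ + log (1 + h * (2 * k)) / h) := by
  have hyk : |y| ≤ k := by linarith
  obtain ⟨hy1, hy2⟩ := abs_le.1 hyk
  obtain ⟨hy3, hy4⟩ := abs_le.1 (by linarith : |y| ≤ k - δ)
  have hC0 : 0 ≤ C := (norm_nonneg _).trans (hC y ⟨hy1, hy2⟩)
  have hbound : ∀ a, δ ≤ a → a ≤ 2 * k →
      2 * C * ((1 + h * a)⁻¹ + log (1 + h * a) / h) ≤
        2 * C * ((1 + h * δ)⁻¹ + log (1 + h * (2 * k)) / h) := fun a h1 h2 => by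
    have ha : 0 ≤ a := hδ.trans h1
    gcongr
  have hr : ‖(∫ t in (0 : ℝ)..(k - y), g (t + y) * dirichletKernel h t) - g y / 2‖ ≤
      2 * C * ((1 + h * δ)⁻¹ + log (1 + h * (2 * k)) / h) := by
    refine le_trans ?_ (hbound (k - y) (by linarith) (by linarith))
    have hm : ∀ t ∈ Icc 0 (k - y), t + y ∈ Icc (-k) k := fun t ht =>
      ⟨by linarith [ht.1], by linarith [ht.2]⟩
    have := norm_integral_mul_dirichletKernel_sub_le (g := fun t => g (t + y))
      (g' := fun t => g' (t + y)) hh (by linarith : 0 ≤ k - y)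
      (fun t ht => (hg _ (hm t ht)).comp_add_const t y)
      (hg'.comp (by fun_prop) hm) (fun t ht => hC _ (hm t ht)) (fun t ht => hC' _ (hm t ht))
    simpa using this
  have hl : ‖(∫ t in (0 : ℝ)..(y + k), g (y - t) * dirichletKernel h t) - g y / 2‖ ≤
      2 * C * ((1 + h * δ)⁻¹ + log (1 + h * (2 * k)) / h) := by
    refine le_trans ?_ (hbound (y + k) (by linarith) (by linarith))
    have hm : ∀ t ∈ Icc 0 (y + k), y - t ∈ Icc (-k) k := fun t ht =>
      ⟨by linarith [ht.2], by linarith [ht.1]⟩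
    have := norm_integral_mul_dirichletKernel_sub_le (g := fun t => g (y - t))
      (g' := fun t => -g' (y - t)) hh (by linarith : 0 ≤ y + k)
      (fun t ht => (hg _ (hm t ht)).comp_const_sub y t)
      ((hg'.comp (by fun_prop) hm).neg) (fun t ht => hC _ (hm t ht))
      (fun t ht => by simpa using hC' _ (hm t ht))
    simpa using this
  have hcont : ContinuousOn (fun t => g t * (dirichletKernel h (t - y) : ℂ)) (Icc (-k) k) :=
    ContinuousOn.mul (fun t ht => (hg t ht).continuousAt.continuousWithinAt)
      (Continuous.continuousOn (by fun_prop))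
  have e1 : ∫ t in y..k, g t * (dirichletKernel h (t - y) : ℂ) =
      ∫ t in (0 : ℝ)..(k - y), g (t + y) * dirichletKernel h t := by
    have := intervalIntegral.integral_comp_add_right (a := 0) (b := k - y)
      (fun t => g t * (dirichletKernel h (t - y) : ℂ)) y
    simpa using this.symm
  have e2 : ∫ t in (-k)..y, g t * (dirichletKernel h (t - y) : ℂ) =
      ∫ t in (0 : ℝ)..(y + k), g (y - t) * dirichletKernel h t := by
    have := intervalIntegral.integral_comp_sub_left (a := 0) (b := y + k)
      (fun t => g t * (dirichletKernel h (t - y) : ℂ)) y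
    simpa [dirichletKernel_neg] using this.symm
  rw [← intervalIntegral.integral_add_adjacent_intervals (b := y)
    ((hcont.mono (Icc_subset_Icc le_rfl hy2)).intervalIntegrable_of_Icc hy1)
    ((hcont.mono (Icc_subset_Icc hy1 le_rfl)).intervalIntegrable_of_Icc hy2), e1, e2]
  have e3 : ∀ a b : ℂ, a + b - g y = (a - g y / 2) + (b - g y / 2) := fun a b => by ring
  rw [e3]
  refine (norm_add_le _ _).trans ?_
  linarith

lemma integral_abs_dirichletKernel_sub_le {h k y : ℝ} (hh : 0 < h) (hy : |y| ≤ k) :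
    ∫ t in (-k)..k, |dirichletKernel h (t - y)| ≤ 2 * log (1 + h * (2 * k)) := by
  obtain ⟨hy1, hy2⟩ := abs_le.1 hy
  have hb : ∀ a, 0 ≤ a → a ≤ 2 * k →
      ∫ t in (0 : ℝ)..a, |dirichletKernel h t| ≤ log (1 + h * (2 * k)) := fun a h1 h2 =>
    (integral_abs_dirichletKernel_le hh h1).trans (by gcongr)
  have e1 : ∫ t in y..k, |dirichletKernel h (t - y)| =
      ∫ t in (0 : ℝ)..(k - y), |dirichletKernel h t| := by
    simpa using intervalIntegral.integral_comp_sub_right (fun t => |dirichletKernel h t|) y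
      (a := y) (b := k)
  have e2 : ∫ t in (-k)..y, |dirichletKernel h (t - y)| =
      ∫ t in (0 : ℝ)..(y + k), |dirichletKernel h t| := by
    have := intervalIntegral.integral_comp_sub_left (a := 0) (b := y + k)
      (fun t => |dirichletKernel h (t - y)|) y
    simpa [dirichletKernel_neg] using this.symm
  rw [← intervalIntegral.integral_add_adjacent_intervals (b := y)
    (Continuous.intervalIntegrable (by fun_prop) _ _)
    (Continuous.intervalIntegrable (by fun_prop) _ _), e1, e2]
  linarith [hb (k - y) (by linarith) (by linarith), hb (y + k) (by linarith) (by linarith)]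

lemma dirichletKernel_eq_integral_exp (h t : ℝ) :
    ((2 * π : ℝ) : ℂ)⁻¹ * ∫ w in (-h)..h, Complex.exp (Complex.I * ((w * t : ℝ) : ℂ)) =
      dirichletKernel h t := by
  rcases eq_or_ne t 0 with rfl | ht
  · simp [dirichletKernel]
    field_simp
    ring
  · have h1 := intervalIntegral.integral_comp_mul_right (a := -h) (b := h)
      (fun w : ℝ => Complex.exp (w * Complex.I)) ht
    rw [neg_mul, integral_exp_mul_I_eq_sinc] at h1
    have h2 : ∀ w : ℝ, Complex.exp (Complex.I * ((w * t : ℝ) : ℂ)) =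
        Complex.exp (((w * t : ℝ) : ℂ) * Complex.I) := fun w => by rw [mul_comm]
    simp_rw [h2]
    rw [h1, dirichletKernel]
    have : (t : ℂ) ≠ 0 := by exact_mod_cast ht
    have : (π : ℂ) ≠ 0 := by exact_mod_cast pi_ne_zero
    simp only [Complex.real_smul]
    push_cast
    field_simp

/-! ### Partial Fourier inversion on cubes -/

/-- The closed cube `{x | ∀ i, |x i| ≤ r}` in `ℝⁿ`. -/
def box (n : ℕ) (r : ℝ) : Set (EuclideanSpace ℝ (Fin n)) := {x | ∀ i, |x i| ≤ r}

variable {n : ℕ}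

lemma box_eq_preimage (r : ℝ) :
    box n r = (fun x : EuclideanSpace ℝ (Fin n) => x.ofLp) ⁻¹'
      (univ.pi fun _ => Icc (-r) r) := by
  ext x
  simp only [box, mem_preimage, mem_univ_pi, mem_Icc, mem_ofPred_eq, abs_le]

lemma box_eq_image (r : ℝ) :
    box n r = (WithLp.toLp 2 : (Fin n → ℝ) → EuclideanSpace ℝ (Fin n)) ''
      (univ.pi fun _ => Icc (-r) r) := by
  rw [box_eq_preimage]
  ext x
  constructor
  · exact fun h => ⟨x.ofLp, h, rfl⟩
  · rintro ⟨z, hz, rfl⟩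
    exact hz

lemma isCompact_box (r : ℝ) : IsCompact (box n r) := by
  rw [box_eq_image]
  exact (isCompact_univ_pi fun _ => isCompact_Icc).image (PiLp.continuous_toLp 2 _)

lemma measurableSet_box (r : ℝ) : MeasurableSet (box n r) :=
  (isCompact_box r).isClosed.measurableSet

lemma box_mono {r s : ℝ} (h : r ≤ s) : box n r ⊆ box n s := fun _ hx i => (hx i).trans h

lemma volume_real_box {r : ℝ} (hr : 0 ≤ r) :
    volume.real (box n r) = (2 * r) ^ n := by
  rw [box_eq_preimage, measureReal_def, (PiLp.volume_preserving_ofLp (Fin n)).measure_preimage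
    (MeasurableSet.univ_pi fun _ => measurableSet_Icc).nullMeasurableSet, volume_pi_pi]
  simp [Real.volume_Icc]
  rw [ENNReal.toReal_ofReal (by linarith)]
  ring

lemma setIntegral_box (r : ℝ) (F : EuclideanSpace ℝ (Fin n) → ℂ) :
    ∫ x in box n r, F x =
      ∫ x, F (WithLp.toLp 2 x) ∂(Measure.pi fun _ => volume.restrict (Icc (-r) r)) := by
  rw [← Measure.restrict_pi_pi, box_eq_preimage, ← volume_pi]
  have := (PiLp.volume_preserving_ofLp (Fin n)).setIntegral_preimage_emb
    (MeasurableEquiv.toLp 2 (Fin n → ℝ)).symm.measurableEmbedding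
    (fun x => F (WithLp.toLp 2 x)) (univ.pi fun _ => Icc (-r) r)
  simpa using this

/-- A product kernel nearly reproduces the value at `y` of a function on a cube as soon as each
factor does so in its own variable: the variables are replaced one at a time, and each
replacement costs at most the one-dimensional error times the `L¹` norms of the other factors. -/
lemma norm_integral_mul_prod_sub_le {k L e : ℝ} (hL : 1 ≤ L) (he : 0 ≤ e) :
    ∀ {n : ℕ} (G : (Fin n → ℝ) → ℂ) (D : Fin n → ℝ → ℂ) (y : Fin n → ℝ),
      (∀ j, Continuous (D j)) → (∀ j, ∫ t in Icc (-k) k, ‖D j t‖ ≤ L) →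
      ContinuousOn G (univ.pi fun _ => Icc (-k) k) → (y ∈ univ.pi fun _ => Icc (-k) k) →
      (∀ j, ∀ x ∈ univ.pi fun _ => Icc (-k) k,
        ‖(∫ t in Icc (-k) k, G (Function.update x j t) * D j t) -
          G (Function.update x j (y j))‖ ≤ e) →
      ‖(∫ x, G x * ∏ j, D j (x j) ∂(Measure.pi fun _ => volume.restrict (Icc (-k) k))) - G y‖ ≤
        n * L ^ n * e
  | 0, G, D, y, _, _, _, _, _ => by
    rw [Measure.pi_of_empty _ y]
    simp
  | n + 1, G, D, y, hD, hDL, hG, hy, H => by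
    set ν : Measure ℝ := volume.restrict (Icc (-k) k) with hν
    have hy' : Fin.tail y ∈ univ.pi fun _ : Fin n => Icc (-k) k := fun j _ => hy j.succ trivial
    have hcons : ∀ t ∈ Icc (-k) k, ∀ z ∈ univ.pi fun _ : Fin n => Icc (-k) k,
        (Fin.cons t z : Fin (n + 1) → ℝ) ∈ univ.pi fun _ => Icc (-k) k := by
      intro t ht z hz j _
      refine Fin.cases ?_ (fun i => ?_) j
      · exact ht
      · exact hz i trivial
    have hccont : Continuous fun p : ℝ × (Fin n → ℝ) => (Fin.cons p.1 p.2 : Fin (n + 1) → ℝ) := by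
      refine continuous_pi fun j => ?_
      refine Fin.cases ?_ (fun i => ?_) j
      · exact continuous_fst
      · exact (continuous_apply i).comp continuous_snd
    have hG' : ContinuousOn (fun z => G (Fin.cons (y 0) z)) (univ.pi fun _ : Fin n => Icc (-k) k) :=
      hG.comp (hccont.comp (by fun_prop : Continuous fun z : Fin n → ℝ => (y 0, z))).continuousOn
        fun z hz => hcons _ (hy 0 trivial) z hz
    have ih := norm_integral_mul_prod_sub_le hL he (fun z => G (Fin.cons (y 0) z))
      (fun j => D j.succ) (Fin.tail y) (fun j => hD _) (fun j => hDL _) hG' hy' (by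
        intro j x hx
        have := H j.succ (Fin.cons (y 0) x) (hcons _ (hy 0 trivial) x hx)
        simpa [Fin.cons_update, Fin.tail] using this)
    simp only [Fin.cons_self_tail] at ih
    have hcompact : IsCompact (univ.pi fun _ : Fin n => Icc (-k) k) :=
      isCompact_univ_pi fun _ => isCompact_Icc
    have hprodc : Continuous fun z : Fin n → ℝ => ∏ j : Fin n, D j.succ (z j) :=
      continuous_finsetProd _ fun j _ => (hD _).comp (continuous_apply j)
    have hint : Integrable (fun p : ℝ × (Fin n → ℝ) =>
        G (Fin.cons p.1 p.2) * (D 0 p.1 * ∏ j : Fin n, D j.succ (p.2 j)))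
        (ν.prod (Measure.pi fun _ => ν)) := by
      rw [hν, ← Measure.restrict_pi_pi, Measure.prod_restrict]
      refine ContinuousOn.integrableOn_compact (isCompact_Icc.prod hcompact) ?_
      refine ContinuousOn.mul (hG.comp hccont.continuousOn fun p hp => hcons _ hp.1 _ hp.2) ?_
      exact (((hD 0).comp continuous_fst).mul (hprodc.comp continuous_snd)).continuousOn
    have hsplit : (∫ x, G x * ∏ j, D j (x j) ∂(Measure.pi fun _ => ν)) =
        ∫ z, (∫ t, G (Fin.cons t z) * D 0 t ∂ν) * ∏ j : Fin n, D j.succ (z j)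
          ∂(Measure.pi fun _ => ν) := by
      have h1 := (measurePreserving_piFinSuccAbove (fun _ : Fin (n + 1) => ν) 0).symm
      rw [← h1.integral_comp (MeasurableEquiv.measurableEmbedding _)]
      have h2 : ∀ p : ℝ × (Fin n → ℝ),
          (MeasurableEquiv.piFinSuccAbove (fun _ : Fin (n + 1) => ℝ) 0).symm p =
            Fin.cons p.1 p.2 := fun p => by
        simp [MeasurableEquiv.piFinSuccAbove]
        rfl
      simp only [h2, Fin.prod_univ_succ, Fin.cons_zero, Fin.cons_succ]
      rw [integral_prod_symm _ hint]
      refine integral_congr_ae (Eventually.of_forall fun z => ?_)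
      simp only
      rw [← integral_mul_const]
      refine integral_congr_ae (Eventually.of_forall fun t => ?_)
      simp only
      ring
    have hint1 : Integrable (fun z => (∫ t, G (Fin.cons t z) * D 0 t ∂ν) *
        ∏ j : Fin n, D j.succ (z j)) (Measure.pi fun _ => ν) := by
      refine hint.integral_prod_right.congr (Eventually.of_forall fun z => ?_)
      simp only
      rw [← integral_mul_const]
      refine integral_congr_ae (Eventually.of_forall fun t => ?_)
      simp only
      ring
    have hint2 : Integrable (fun z => G (Fin.cons (y 0) z) *
        ∏ j : Fin n, D j.succ (z j)) (Measure.pi fun _ => ν) := by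
      rw [hν, ← Measure.restrict_pi_pi]
      exact (hG'.mul hprodc.continuousOn).integrableOn_compact hcompact
    have hint3 : Integrable (fun z : Fin n → ℝ => ∏ j : Fin n, ‖D j.succ (z j)‖)
        (Measure.pi fun _ => ν) := by
      rw [hν, ← Measure.restrict_pi_pi]
      refine ContinuousOn.integrableOn_compact hcompact (Continuous.continuousOn ?_)
      exact continuous_finsetProd _ fun j _ => ((hD _).comp (continuous_apply j)).norm
    have hdiff : ‖(∫ x, G x * ∏ j, D j (x j) ∂(Measure.pi fun _ => ν)) -
        ∫ z, G (Fin.cons (y 0) z) * ∏ j : Fin n, D j.succ (z j) ∂(Measure.pi fun _ => ν)‖ ≤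
        L ^ n * e := by
      rw [hsplit, ← integral_sub hint1 hint2]
      have hle : ∫ z : Fin n → ℝ, ∏ j : Fin n, ‖D j.succ (z j)‖ ∂(Measure.pi fun _ => ν) ≤
          L ^ n := by
        rw [integral_fintype_prod_eq_prod (𝕜 := ℝ) (fun j t => ‖D (Fin.succ j) t‖)]
        refine (Finset.prod_le_prod (fun j _ => integral_nonneg fun t => norm_nonneg _)
          fun j _ => hDL j.succ).trans_eq ?_
        simp
      refine le_trans ?_ (mul_le_mul_of_nonneg_right hle he)
      rw [← integral_mul_const]
      refine norm_integral_le_of_norm_le (hint3.mul_const e) ?_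
      have hmem : ∀ᵐ z ∂(Measure.pi fun _ : Fin n => ν), z ∈ univ.pi fun _ => Icc (-k) k := by
        rw [hν, ← Measure.restrict_pi_pi]
        exact ae_restrict_mem (MeasurableSet.univ_pi fun _ => measurableSet_Icc)
      filter_upwards [hmem] with z hz
      have h1 := H 0 (Fin.cons (y 0) z) (hcons _ (hy 0 trivial) z hz)
      simp only [Fin.update_cons_zero] at h1
      rw [← sub_mul, norm_mul, norm_prod, mul_comm]
      exact mul_le_mul_of_nonneg_left h1 (Finset.prod_nonneg fun j _ => norm_nonneg _)
    have h5 : L ^ n ≤ L ^ (n + 1) := pow_le_pow_right₀ hL (Nat.le_succ n)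
    calc _ ≤ L ^ n * e + n * L ^ n * e := (norm_sub_le_norm_sub_add_norm_sub _ _ _).trans
          (add_le_add hdiff ih)
      _ = (n + 1) * (L ^ n * e) := by ring
      _ ≤ (n + 1) * (L ^ (n + 1) * e) := by gcongr
      _ = _ := by
        push_cast
        ring

/-- The partial Fourier transform over the cube `[-k, k]ⁿ`, with the sign `σ = ± 1` in the
phase `e^{iσ x·w}`. -/
noncomputable def boxFourier (k σ : ℝ) (F : EuclideanSpace ℝ (Fin n) → ℂ)
    (w : EuclideanSpace ℝ (Fin n)) : ℂ :=
  ∫ x in box n k, F x * Complex.exp (Complex.I * ((σ * ∑ i, x i * w i : ℝ) : ℂ))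

/-- Composing two partial Fourier transforms of opposite signs amounts to integrating against
a product of Dirichlet kernels. -/
lemma boxFourier_boxFourier {k h σ : ℝ} (hh : 0 ≤ h) (hσ : σ = 1 ∨ σ = -1)
    {F : EuclideanSpace ℝ (Fin n) → ℂ} (hF : ContinuousOn F (box n k))
    (y : EuclideanSpace ℝ (Fin n)) :
    (((2 * π) ^ n : ℝ) : ℂ)⁻¹ * boxFourier h σ (boxFourier k (-σ) F) y =
      ∫ x in box n k, F x * ∏ i, (dirichletKernel h (x i - y i) : ℂ) := by
  have hfun : ∀ w x : EuclideanSpace ℝ (Fin n),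
      F x * Complex.exp (Complex.I * ((-σ * ∑ i, x i * w i : ℝ) : ℂ)) *
        Complex.exp (Complex.I * ((σ * ∑ i, w i * y i : ℝ) : ℂ)) =
      F x * ∏ i, Complex.exp (Complex.I * ((w i * (σ * (y i - x i)) : ℝ) : ℂ)) := by
    intro w x
    rw [mul_assoc, ← Complex.exp_add, ← Complex.exp_sum, ← Finset.mul_sum, ← mul_add]
    congr 3
    rw [← Complex.ofReal_sum, ← Complex.ofReal_add]
    congr 1
    rw [Finset.mul_sum, Finset.mul_sum, ← Finset.sum_add_distrib]
    exact Finset.sum_congr rfl fun i _ => by ring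
  have hint : Integrable (Function.uncurry fun w x : EuclideanSpace ℝ (Fin n) =>
      F x * ∏ i, Complex.exp (Complex.I * ((w i * (σ * (y i - x i)) : ℝ) : ℂ)))
      ((volume.restrict (box n h)).prod (volume.restrict (box n k))) := by
    rw [Measure.prod_restrict]
    refine ContinuousOn.integrableOn_compact ((isCompact_box h).prod (isCompact_box k)) ?_
    refine ContinuousOn.mul (hF.comp continuous_snd.continuousOn fun p hp => hp.2) ?_
    exact Continuous.continuousOn (by fun_prop)
  have hcoef : ∀ x : EuclideanSpace ℝ (Fin n), (((2 * π) ^ n : ℝ) : ℂ)⁻¹ * ∫ w in box n h,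
      F x * ∏ i, Complex.exp (Complex.I * ((w i * (σ * (y i - x i)) : ℝ) : ℂ)) =
      F x * ∏ i, (dirichletKernel h (x i - y i) : ℂ) := by
    intro x
    rw [integral_const_mul, setIntegral_box]
    simp only
    rw [integral_fintype_prod_eq_prod (𝕜 := ℂ)
      (fun i t => Complex.exp (Complex.I * ((t * (σ * (y i - x i)) : ℝ) : ℂ)))]
    have h1 : ∀ i : Fin n, (dirichletKernel h (x i - y i) : ℂ) = ((2 * π : ℝ) : ℂ)⁻¹ *
        ∫ t in Icc (-h) h, Complex.exp (Complex.I * ((t * (σ * (y i - x i)) : ℝ) : ℂ)) := by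
      intro i
      rw [integral_Icc_eq_integral_Ioc, ← intervalIntegral.integral_of_le (by linarith),
        dirichletKernel_eq_integral_exp]
      rcases hσ with rfl | rfl
      · rw [← dirichletKernel_neg]
        congr 2
        ring
      · congr 2
        ring
    simp only [h1]
    rw [Finset.prod_mul_distrib, Finset.prod_const]
    simp only [Finset.card_univ, Fintype.card_fin]
    push_cast
    rw [inv_pow]
    ring
  calc _ = (((2 * π) ^ n : ℝ) : ℂ)⁻¹ * ∫ w in box n h, ∫ x in box n k,
        F x * ∏ i, Complex.exp (Complex.I * ((w i * (σ * (y i - x i)) : ℝ) : ℂ)) := by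
        unfold boxFourier
        congr 1
        refine integral_congr_ae (Eventually.of_forall fun w => ?_)
        simp only
        rw [← integral_mul_const]
        exact integral_congr_ae (Eventually.of_forall fun x => hfun w x)
    _ = ∫ x in box n k, (((2 * π) ^ n : ℝ) : ℂ)⁻¹ * ∫ w in box n h,
        F x * ∏ i, Complex.exp (Complex.I * ((w i * (σ * (y i - x i)) : ℝ) : ℂ)) := by
        rw [integral_integral_swap hint, integral_const_mul]
    _ = _ := integral_congr_ae (Eventually.of_forall hcoef)

open RobinsonColombeau in
lemma hasDerivAt_update {Ω : Set (EuclideanSpace ℝ (Fin n))} {F : EuclideanSpace ℝ (Fin n) → ℂ}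
    (hΩ : IsOpen Ω) (hF : ContDiffOn ℝ ∞ F Ω) (x : Fin n → ℝ) (j : Fin n) (t : ℝ)
    (ht : WithLp.toLp 2 (Function.update x j t) ∈ Ω) :
    HasDerivAt (fun t => F (WithLp.toLp 2 (Function.update x j t)))
      (partialDeriv ![j] F (WithLp.toLp 2 (Function.update x j t))) t := by
  have h1 : HasFDerivAt F (fderiv ℝ F (WithLp.toLp 2 (Function.update x j t)))
      (WithLp.toLp 2 (Function.update x j t)) :=
    ((hF.contDiffAt (hΩ.mem_nhds ht)).differentiableAt (by simp)).hasFDerivAt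
  have h2 : HasDerivAt (fun t => (WithLp.toLp 2 (Function.update x j t) : EuclideanSpace ℝ (Fin n)))
      (EuclideanSpace.single j 1) t := by
    have h3 : (fun t => (WithLp.toLp 2 (Function.update x j t) : EuclideanSpace ℝ (Fin n))) =
        fun t => WithLp.toLp 2 (Function.update x j 0) + t • EuclideanSpace.single j (1 : ℝ) := by
      funext t
      ext i
      rcases eq_or_ne i j with rfl | hij
      · simp
      · simp [hij]
    rw [h3]
    simpa using! ((hasDerivAt_id t).smul_const (EuclideanSpace.single j (1 : ℝ))).const_add
      (WithLp.toLp 2 (Function.update x j 0))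
  have := h1.comp_hasDerivAt t h2
  simpa [partialDeriv, iteratedFDeriv_one_apply] using! this

open RobinsonColombeau in
/-- Pointwise Fourier inversion on the cube `[-k, k]ⁿ` with an explicit rate. -/
lemma norm_boxFourier_boxFourier_sub_le {Ω : Set (EuclideanSpace ℝ (Fin n))}
    {F : EuclideanSpace ℝ (Fin n) → ℂ} {h k δ C σ : ℝ} {y : EuclideanSpace ℝ (Fin n)}
    (hΩ : IsOpen Ω) (hF : ContDiffOn ℝ ∞ F Ω) (hk : 0 ≤ k) (hkΩ : box n k ⊆ Ω) (hh : 0 < h)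
    (hδ : 0 ≤ δ) (hy : ∀ i, |y i| + δ ≤ k) (hC : 0 ≤ C) (hFC : ∀ x ∈ box n k, ‖F x‖ ≤ C)
    (hFC' : ∀ x ∈ box n k, ∀ j, ‖partialDeriv ![j] F x‖ ≤ C) (hσ : σ = 1 ∨ σ = -1) :
    ‖(((2 * π) ^ n : ℝ) : ℂ)⁻¹ * boxFourier h σ (boxFourier k (-σ) F) y - F y‖ ≤
      n * (1 + 2 * log (1 + h * (2 * k))) ^ n *
        (4 * C * ((1 + h * δ)⁻¹ + log (1 + h * (2 * k)) / h)) := by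
  have hlog : 0 ≤ log (1 + h * (2 * k)) := log_nonneg (by nlinarith [mul_nonneg hh.le hk])
  rw [boxFourier_boxFourier hh.le hσ (hF.continuousOn.mono hkΩ), setIntegral_box]
  have hmem : ∀ x ∈ (univ.pi fun _ : Fin n => Icc (-k) k), ∀ (j : Fin n), ∀ t ∈ Icc (-k) k,
      (WithLp.toLp 2 (Function.update x j t) : EuclideanSpace ℝ (Fin n)) ∈ box n k := by
    intro x hx j t ht i
    rcases eq_or_ne i j with rfl | hij
    · simpa [abs_le] using ht
    · simpa [hij, abs_le] using hx i trivial
  refine norm_integral_mul_prod_sub_le (by linarith) (by positivity)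
    (fun x => F (WithLp.toLp 2 x)) (fun i t => (dirichletKernel h (t - y i) : ℂ)) y.ofLp
    (fun j => by fun_prop) (fun j => ?_) ?_ ?_ ?_
  · simp only [Complex.norm_real, norm_eq_abs]
    rw [integral_Icc_eq_integral_Ioc, ← intervalIntegral.integral_of_le (by linarith)]
    linarith [integral_abs_dirichletKernel_sub_le hh (by linarith [hy j] : |y j| ≤ k)]
  · refine (hF.continuousOn.mono hkΩ).comp (PiLp.continuous_toLp 2 _).continuousOn fun x hx i => ?_
    simpa [abs_le] using hx i trivial
  · exact fun i _ => abs_le.1 (by linarith [hy i])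
  · intro j x hx
    rw [integral_Icc_eq_integral_Ioc, ← intervalIntegral.integral_of_le (by linarith)]
    have hd : ∀ t ∈ Icc (-k) k, HasDerivAt (fun t => F (WithLp.toLp 2 (Function.update x j t)))
        (partialDeriv ![j] F (WithLp.toLp 2 (Function.update x j t))) t := fun t ht =>
      hasDerivAt_update hΩ hF x j t (hkΩ (hmem x hx j t ht))
    refine norm_integral_mul_dirichletKernel_sub_le_of_interior (k := k) (y := y j) hh hδ (hy j)
      hd ?_ (fun t ht => hFC _ (hmem x hx j t ht)) (fun t ht => hFC' _ (hmem x hx j t ht) j)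
    have hc : ContinuousOn (fun z => partialDeriv ![j] F z) Ω := by
      have h1 : ContinuousOn (fderiv ℝ F) Ω := hF.continuousOn_fderiv_of_isOpen hΩ (by simp)
      simpa [partialDeriv, iteratedFDeriv_one_apply] using h1.clm_apply continuousOn_const
    refine hc.comp (Continuous.continuousOn ?_) fun t ht => hkΩ (hmem x hx j t ht)
    exact (PiLp.continuous_toLp 2 _).comp (continuous_const.update j continuous_id)

lemma log_pow_le {X : ℝ} (hX : 1 ≤ X) (m : ℕ) :
    log X ^ m ≤ 2 ^ m * m.factorial * √X := by
  have h := pow_div_factorial_le_exp (x := log X / 2) (by linarith [log_nonneg hX]) m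
  have h2 : exp (log X / 2) = √X := by
    rw [exp_half, exp_log (by linarith)]
  rw [h2, div_pow, div_div, div_le_iff₀ (by positivity)] at h
  linarith

/-- The error bound of the cubic partial Fourier integrals decays like `h^(-1/2)`: the powers of
logarithms coming from the `L¹` norms of the Dirichlet kernels are dominated by `√h`. -/
lemma exists_rate_le (n : ℕ) : ∃ c : ℝ, 0 ≤ c ∧ ∀ h r a δ C : ℝ, 1 ≤ h → 0 ≤ r → r + 1 ≤ a →
    0 < δ → δ ≤ 1 → 0 ≤ C →
    n * (1 + 2 * log (1 + h * (2 * r))) ^ n *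
      (4 * C * ((1 + h * δ)⁻¹ + log (1 + h * (2 * r)) / h)) ≤ c * (C * a * δ⁻¹) * (√h)⁻¹ := by
  refine ⟨n * 4 * 2 * (2 ^ (n + 1) * (2 ^ (n + 1) * (n + 1).factorial * 3)), by positivity, ?_⟩
  intro h r a δ C hh hr ha hδ hδ1 hC
  have hh0 : 0 < h := by linarith
  have ha1 : 1 ≤ a := by linarith
  set H := 1 + h * (2 * r) with hH
  have hH1 : 1 ≤ H := by nlinarith [mul_nonneg hh0.le hr]
  have hlog : 0 ≤ log H := log_nonneg hH1
  set l := 1 + 2 * log H with hl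
  have hl1 : 1 ≤ l := by linarith
  have hHa : H ≤ 2 * (h * a) := by nlinarith
  have he : exp 1 * H ≤ 9 * (h * a) := by
    nlinarith [exp_one_lt_three, mul_pos hh0 (by linarith : 0 < a)]
  -- `l ≤ 2 log (e H)`, and powers of the logarithm are bounded by the square root
  have hlpow : l ^ (n + 1) ≤
      2 ^ (n + 1) * (2 ^ (n + 1) * (n + 1).factorial * (3 * (√h * a))) := by
    have h1 : l ≤ 2 * log (exp 1 * H) := by
      rw [log_mul (exp_pos _).ne' (by linarith), log_exp]
      linarith
    have h2 : 1 ≤ exp 1 * H := by nlinarith [add_one_le_exp (1 : ℝ)]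
    have h3 : √(exp 1 * H) ≤ 3 * (√h * a) := by
      rw [sqrt_le_left (by positivity)]
      have h4 : (3 * (√h * a)) ^ 2 = 9 * (h * a) * a := by
        rw [mul_pow, mul_pow, sq_sqrt hh0.le]
        ring
      rw [h4]
      nlinarith [mul_pos hh0 (by linarith : 0 < a)]
    calc l ^ (n + 1) ≤ (2 * log (exp 1 * H)) ^ (n + 1) := by gcongr
      _ = 2 ^ (n + 1) * log (exp 1 * H) ^ (n + 1) := mul_pow _ _ _
      _ ≤ _ := by
        gcongr
        refine (log_pow_le h2 _).trans ?_
        gcongr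
  have hsum : l ^ n * ((1 + h * δ)⁻¹ + log H / h) ≤ 2 * l ^ (n + 1) * (h⁻¹ * δ⁻¹) := by
    have h1 : (1 + h * δ)⁻¹ ≤ l * (h⁻¹ * δ⁻¹) := by
      rw [← mul_inv]
      have : (1 + h * δ)⁻¹ ≤ (h * δ)⁻¹ := inv_anti₀ (by positivity) (by linarith)
      have h2 : 0 < (h * δ)⁻¹ := by positivity
      nlinarith
    have h2 : log H / h ≤ l * (h⁻¹ * δ⁻¹) := by
      have h3 : 1 ≤ δ⁻¹ := (one_le_inv₀ hδ).2 hδ1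
      have h4 : 0 < h⁻¹ := by positivity
      rw [div_eq_mul_inv]
      have h5 : log H ≤ l := by linarith
      have h6 : h⁻¹ ≤ h⁻¹ * δ⁻¹ := by nlinarith
      exact mul_le_mul h5 h6 h4.le (by linarith)
    calc _ ≤ l ^ n * (l * (h⁻¹ * δ⁻¹) + l * (h⁻¹ * δ⁻¹)) := by gcongr
      _ = _ := by ring
  have hsq : h⁻¹ = (√h)⁻¹ * (√h)⁻¹ := by
    rw [← mul_inv, mul_self_sqrt hh0.le]
  have hs : √h ≠ 0 := (sqrt_pos.2 hh0).ne'
  calc _ = n * 4 * C * (l ^ n * ((1 + h * δ)⁻¹ + log H / h)) := by ring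
    _ ≤ n * 4 * C * (2 * (2 ^ (n + 1) * (2 ^ (n + 1) * (n + 1).factorial * (3 * (√h * a)))) *
        (h⁻¹ * δ⁻¹)) := by
      refine mul_le_mul_of_nonneg_left (hsum.trans ?_) (by positivity)
      gcongr
    _ = _ := by
      rw [hsq]
      field_simp

/-- Partial Fourier transforms of continuous functions are continuous. -/
lemma continuous_boxFourier {k : ℝ} (σ : ℝ) {F : EuclideanSpace ℝ (Fin n) → ℂ}
    (hF : ContinuousOn F (box n k)) : Continuous (boxFourier k σ F) := by
  have hFi : IntegrableOn F (box n k) := hF.integrableOn_compact (isCompact_box k)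
  refine continuous_of_dominated (bound := fun x => ‖F x‖) (fun w => ?_)
    (fun w => Eventually.of_forall fun x => ?_) hFi.norm (Eventually.of_forall fun x => ?_)
  · exact hFi.aestronglyMeasurable.mul (Continuous.aestronglyMeasurable (by fun_prop))
  · rw [norm_mul, Complex.norm_exp_I_mul_ofReal, mul_one]
  · fun_prop

lemma boxFourier_const_mul (k σ : ℝ) (c : ℂ) (F : EuclideanSpace ℝ (Fin n) → ℂ)
    (w : EuclideanSpace ℝ (Fin n)) :
    boxFourier k σ (fun x => c * F x) w = c * boxFourier k σ F w := by
  unfold boxFourier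
  rw [← integral_const_mul]
  simp only [mul_assoc]

end DirichletKernel

namespace RobinsonColombeau

open DirichletKernel

variable {ρ : Gauge} {n : ℕ} {𝕜 : Type*} [RCLike 𝕜]

/-! ### Calculus of representatives -/

lemma Negligible.moderate {E : Type*} [SeminormedAddCommGroup E] {x : Idx → E}
    (hx : Negligible ρ x) : Moderate ρ x :=
  ⟨0, (hx 0).mono fun ε h => by simpa using h⟩

lemma negligible_zero {E : Type*} [SeminormedAddCommGroup E] :
    Negligible ρ (fun _ => (0 : E)) :=
  fun m => Eventually.of_forall fun ε => by simpa using pow_nonneg (ρ.pos ε).le m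

lemma Represents.ofNet {u : Idx → 𝕜} (hu : Moderate ρ u) : Represents u (RC.ofNet ρ u) :=
  represents_ofNet hu (by simpa using negligible_zero) hu

lemma Represents.of_negligible {u v : Idx → 𝕜} {x : RC ρ 𝕜} (hu : Represents u x)
    (h : Negligible ρ fun ε => v ε - u ε) : Represents v x := by
  have hv : Moderate ρ v := by simpa using hu.moderate.add h.moderate
  obtain ⟨hu, rfl⟩ := hu
  exact ⟨hv, Ideal.Quotient.eq.2 h⟩

lemma Represents.eq_of_negligible {u v : Idx → 𝕜} {x y : RC ρ 𝕜} (hu : Represents u x)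
    (hv : Represents v y) (h : Negligible ρ fun ε => u ε - v ε) : x = y := by
  obtain ⟨hu, rfl⟩ := hu
  obtain ⟨hv, rfl⟩ := hv
  exact Ideal.Quotient.eq.2 h

lemma Represents.add {u v : Idx → 𝕜} {x y : RC ρ 𝕜} (hu : Represents u x)
    (hv : Represents v y) : Represents (fun ε => u ε + v ε) (x + y) := by
  obtain ⟨hu, rfl⟩ := hu
  obtain ⟨hv, rfl⟩ := hv
  exact ⟨add_mem hu hv, rfl⟩

lemma Represents.neg {u : Idx → 𝕜} {x : RC ρ 𝕜} (hu : Represents u x) :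
    Represents (fun ε => -u ε) (-x) := by
  obtain ⟨hu, rfl⟩ := hu
  exact ⟨neg_mem hu, rfl⟩

lemma Represents.sub {u v : Idx → 𝕜} {x y : RC ρ 𝕜} (hu : Represents u x)
    (hv : Represents v y) : Represents (fun ε => u ε - v ε) (x - y) := by
  simpa [sub_eq_add_neg] using hu.add hv.neg

lemma Represents.mul {u v : Idx → 𝕜} {x y : RC ρ 𝕜} (hu : Represents u x)
    (hv : Represents v y) : Represents (fun ε => u ε * v ε) (x * y) := by
  obtain ⟨hu, rfl⟩ := hu
  obtain ⟨hv, rfl⟩ := hv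
  exact ⟨mul_mem hu hv, rfl⟩

lemma Represents.smul (c : ℝ) {u : Idx → 𝕜} {x : RC ρ 𝕜} (hu : Represents u x) :
    Represents (fun ε => c • u ε) (c • x) := by
  obtain ⟨hu, rfl⟩ := hu
  exact ⟨(moderateNets ρ 𝕜).smul_mem hu c, rfl⟩

lemma represents_zero : Represents (fun _ => (0 : 𝕜)) (0 : RC ρ 𝕜) :=
  ⟨(moderateNets ρ 𝕜).zero_mem, rfl⟩

lemma represents_one : Represents (fun _ => (1 : 𝕜)) (1 : RC ρ 𝕜) :=
  ⟨(moderateNets ρ 𝕜).one_mem, rfl⟩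

lemma Represents.sum {ι : Type*} (s : Finset ι) {u : ι → Idx → 𝕜} {x : ι → RC ρ 𝕜}
    (h : ∀ i ∈ s, Represents (u i) (x i)) :
    Represents (fun ε => ∑ i ∈ s, u i ε) (∑ i ∈ s, x i) := by
  classical
  induction s using Finset.induction_on with
  | empty => simpa using represents_zero
  | insert a s ha ih =>
    simp only [Finset.sum_insert ha]
    exact (h a (by simp)).add (ih fun i hi => h i (by simp [hi]))

lemma Represents.pow {u : Idx → 𝕜} {x : RC ρ 𝕜} (hu : Represents u x) (q : ℕ) :
    Represents (fun ε => u ε ^ q) (x ^ q) := by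
  induction q with
  | zero => simpa using represents_one
  | succ q ih =>
    simp only [pow_succ]
    exact ih.mul hu

lemma RepresentsPt.dotProduct {u v : Idx → EuclideanSpace ℝ (Fin n)} {x y : Pt ρ n}
    (hu : RepresentsPt u x) (hv : RepresentsPt v y) :
    Represents (fun ε => ∑ i, u ε i * v ε i) (x ⬝ᵥ y) :=
  Represents.sum _ fun i _ => (hu i).mul (hv i)

lemma RepresentsPt.of_negligible {u v : Idx → EuclideanSpace ℝ (Fin n)} {x : Pt ρ n}
    (hu : RepresentsPt u x) (h : ∀ i, Negligible ρ fun ε => v ε i - u ε i) : RepresentsPt v x :=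
  fun i => (hu i).of_negligible (h i)

lemma exists_representsPt {u : Idx → EuclideanSpace ℝ (Fin n)}
    (h : ∀ i, Moderate ρ fun ε => u ε i) : ∃ x : Pt ρ n, RepresentsPt u x :=
  ⟨fun i => RC.ofNet ρ fun ε => u ε i, fun i => Represents.ofNet (h i)⟩

lemma Gauge.pow_anti (ρ : Gauge) (ε : Idx) {m m' : ℕ} (h : m ≤ m') : ρ ε ^ m' ≤ ρ ε ^ m :=
  pow_le_pow_of_le_one (ρ.pos ε).le (ρ.le_one ε) h

lemma Gauge.inv_pow_mono (ρ : Gauge) (ε : Idx) {m m' : ℕ} (h : m ≤ m') :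
    (ρ ε ^ m)⁻¹ ≤ (ρ ε ^ m')⁻¹ :=
  inv_anti₀ (pow_pos (ρ.pos ε) _) (ρ.pow_anti ε h)

/-- A real constant is absorbed by one power of the gauge. -/
lemma Gauge.eventually_mul_pow_le (ρ : Gauge) (c : ℝ) (q : ℕ) :
    ∀ᶠ ε in atBot, c * ρ ε ^ (q + 1) ≤ ρ ε ^ q := by
  filter_upwards [ρ.eventually_le (c := (|c| + 1)⁻¹) (by positivity)] with ε h
  have hp := pow_pos (ρ.pos ε) q
  have h2 : |c| * ρ ε ≤ 1 := by
    have := (le_inv_comm₀ (ρ.pos ε) (by positivity)).1 h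
    have h3 : (|c| + 1) * ρ ε ≤ 1 := by
      rwa [← one_div, le_div_iff₀ (ρ.pos ε)] at this
    nlinarith [ρ.pos ε]
  have h3 : c * ρ ε ≤ 1 := (mul_le_mul_of_nonneg_right (le_abs_self c) (ρ.pos ε).le).trans h2
  rw [pow_succ]
  nlinarith

lemma Gauge.eventually_le_inv_pow (ρ : Gauge) (c : ℝ) :
    ∀ᶠ ε in atBot, c ≤ (ρ ε ^ 1)⁻¹ := by
  obtain h := ρ.eventually_mul_pow_le c 0
  filter_upwards [h] with ε h
  rw [← one_div, le_div_iff₀ (pow_pos (ρ.pos ε) _)]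
  simpa using h

lemma negligible_of_le_mul {E : Type*} [SeminormedAddCommGroup E] {x : Idx → E} (c : ℝ)
    (h : ∀ q : ℕ, ∀ᶠ ε in atBot, ‖x ε‖ ≤ c * ρ ε ^ q) : Negligible ρ x := fun m => by
  filter_upwards [h (m + 1), ρ.eventually_mul_pow_le c m] with ε h1 h2 using h1.trans h2

lemma le_iff_of_represents {u v : Idx → ℝ} {x y : RC ρ ℝ} (hu : Represents u x)
    (hv : Represents v y) : x ≤ y ↔ ∀ m : ℕ, ∀ᶠ ε in atBot, u ε ≤ v ε + ρ ε ^ m := by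
  constructor
  · rintro ⟨u', v', z, hu', hv', hz, h⟩ m
    have h1 := ((hu.negligible_sub hu').add (hv'.negligible_sub hv)).add hz
    filter_upwards [h, h1 m] with ε h2 h3
    have := (le_abs_self _).trans h3
    linarith
  · intro h
    refine ⟨u, v, fun ε => max (u ε - v ε) 0, hu, hv, fun m => ?_, Eventually.of_forall fun ε => ?_⟩
    · filter_upwards [h m] with ε hε
      rw [Real.norm_of_nonneg (le_max_right _ _)]
      exact max_le (by linarith) (pow_pos (ρ.pos ε) m).le
    · linarith [le_max_left (u ε - v ε) 0]

lemma abs_sub_le_d_pow {u v : Idx → 𝕜} {x y : RC ρ 𝕜} (hu : Represents u x)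
    (hv : Represents v y) {q : ℕ} (h : ∀ᶠ ε in atBot, ‖u ε - v ε‖ ≤ ρ ε ^ q) :
    (x - y).abs ≤ ρ.d ^ q := by
  rw [le_iff_of_represents (hu.sub hv).abs (ρ.represents_d.pow q)]
  intro m
  filter_upwards [h] with ε hε
  linarith [pow_pos (ρ.pos ε) m]

lemma eventually_norm_sub_le_of_abs_sub_le {u v : Idx → 𝕜} {x y : RC ρ 𝕜}
    (hu : Represents u x) (hv : Represents v y) {q : ℕ} (h : (x - y).abs ≤ ρ.d ^ q) :
    ∀ᶠ ε in atBot, ‖u ε - v ε‖ ≤ 2 * ρ ε ^ q := by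
  rw [le_iff_of_represents (hu.sub hv).abs (ρ.represents_d.pow q)] at h
  filter_upwards [h q] with ε hε
  linarith

/-- Invertible generalized numbers are bounded away from zero by a power of the gauge. -/
lemma eventually_pow_le_of_isUnit {u : Idx → 𝕜} {x : RC ρ 𝕜} (hu : Represents u x)
    (hx : IsUnit x) : ∃ N : ℕ, ∀ᶠ ε in atBot, ρ ε ^ N ≤ ‖u ε‖ := by
  obtain ⟨y, hy⟩ := hx.exists_right_inv
  obtain ⟨v, hv⟩ := exists_represents y
  have h1 := (hu.mul hv).negligible_sub (hy ▸ represents_one)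
  obtain ⟨N, hN⟩ := hv.moderate
  refine ⟨N + 1, ?_⟩
  filter_upwards [h1 1, hN, ρ.eventually_le (c := 2⁻¹) (by norm_num)] with ε h2 h3 h4
  have hp := pow_pos (ρ.pos ε) N
  have h5 : 1 ≤ ‖u ε * v ε - 1‖ + ‖u ε * v ε‖ := by
    have := norm_sub_norm_le (1 : 𝕜) (u ε * v ε)
    rw [norm_sub_rev, norm_one] at this
    linarith
  have h6 : 2⁻¹ ≤ ‖u ε‖ * ‖v ε‖ := by
    rw [← norm_mul]
    rw [pow_one] at h2
    linarith
  have h7 : 2⁻¹ ≤ ‖u ε‖ * (ρ ε ^ N)⁻¹ :=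
    h6.trans (mul_le_mul_of_nonneg_left h3 (norm_nonneg _))
  rw [← div_eq_mul_inv, le_div_iff₀ hp] at h7
  rw [pow_succ]
  nlinarith

lemma isUnit_of_eventually_pow_le {u : Idx → 𝕜} {x : RC ρ 𝕜} (hu : Represents u x) {N : ℕ}
    (h : ∀ᶠ ε in atBot, ρ ε ^ N ≤ ‖u ε‖) : IsUnit x := by
  have hv : Moderate ρ fun ε => (u ε)⁻¹ :=
    ⟨N, h.mono fun ε hε => by
      rw [norm_inv]
      exact inv_anti₀ (pow_pos (ρ.pos ε) N) hε⟩
  refine IsUnit.of_mul_eq_one (RC.ofNet ρ fun ε => (u ε)⁻¹)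
    ((hu.mul (Represents.ofNet hv)).eq_of_negligible represents_one fun m => ?_)
  filter_upwards [h] with ε hε
  have h0 : u ε ≠ 0 := norm_pos_iff.1 ((pow_pos (ρ.pos ε) N).trans_le hε)
  simp [h0, (pow_pos (ρ.pos ε) m).le]

lemma lt_iff_of_represents {u v : Idx → ℝ} {x y : RC ρ ℝ} (hu : Represents u x)
    (hv : Represents v y) : x < y ↔ ∃ N : ℕ, ∀ᶠ ε in atBot, u ε + ρ ε ^ N ≤ v ε := by
  constructor
  · rintro ⟨hle, hunit⟩
    obtain ⟨N, hN⟩ := eventually_pow_le_of_isUnit (hu.sub hv) hunit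
    refine ⟨N, ?_⟩
    filter_upwards [hN, (le_iff_of_represents hu hv).1 hle (N + 1),
      ρ.eventually_le (c := 2⁻¹) (by norm_num)] with ε h1 h2 h3
    have hp := pow_pos (ρ.pos ε) N
    rw [pow_succ] at h2
    rw [Real.norm_eq_abs, le_abs] at h1
    rcases h1 with h1 | h1
    · nlinarith
    · linarith
  · rintro ⟨N, hN⟩
    refine ⟨(le_iff_of_represents hu hv).2 fun m => ?_,
      isUnit_of_eventually_pow_le (hu.sub hv) (N := N) ?_⟩
    · filter_upwards [hN] with ε hε
      linarith [pow_pos (ρ.pos ε) N, pow_pos (ρ.pos ε) m]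
    · filter_upwards [hN] with ε hε
      rw [Real.norm_eq_abs, le_abs]
      right
      linarith

lemma mem_cube_iff {u : Idx → EuclideanSpace ℝ (Fin n)} {x : Pt ρ n} (hu : RepresentsPt u x)
    {k : RC ρ ℝ} {r : Idx → ℝ} (hr : Represents r k) :
    x ∈ cube n k ↔ ∀ m : ℕ, ∀ᶠ ε in atBot, u ε ∈ box n (r ε + ρ ε ^ m) := by
  have h1 : ∀ i, (-k ≤ x i ↔ ∀ m : ℕ, ∀ᶠ ε in atBot, -r ε ≤ u ε i + ρ ε ^ m) := fun i =>
    le_iff_of_represents hr.neg (hu i)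
  have h2 : ∀ i, (x i ≤ k ↔ ∀ m : ℕ, ∀ᶠ ε in atBot, u ε i ≤ r ε + ρ ε ^ m) := fun i =>
    le_iff_of_represents (hu i) hr
  constructor
  · intro h m
    refine eventually_all.2 fun i => ?_
    filter_upwards [(h1 i).1 (h i).1 m, (h2 i).1 (h i).2 m] with ε h3 h4
    exact abs_le.2 ⟨by linarith, h4⟩
  · intro h i
    refine ⟨(h1 i).2 fun m => ?_, (h2 i).2 fun m => ?_⟩
    · filter_upwards [h m] with ε hε
      linarith [(abs_le.1 (hε i)).1]
    · filter_upwards [h m] with ε hε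
      exact (abs_le.1 (hε i)).2

/-! ### Diagonal nets and uniformity -/

instance : NoMinOrder Idx :=
  ⟨fun a => ⟨⟨a.1 / 2, half_pos a.2.1, (half_le_self a.2.1.le).trans a.2.2⟩,
    Subtype.mk_lt_mk.2 (half_lt_self a.2.1)⟩⟩

instance : Nonempty Idx := ⟨⟨1, one_pos, le_rfl⟩⟩

/-- Diagonal argument: properties that hold frequently for each `m` hold on a common set of
indices accumulating at `0`, with a parameter `m = μ_ε` that tends to infinity. -/
lemma exists_diagonal {P : ℕ → Idx → Prop} (h : ∀ m, ∃ᶠ ε in atBot, P m ε) :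
    ∃ (B : Set Idx) (μ : Idx → ℕ), (∃ᶠ ε in atBot, ε ∈ B) ∧ (∀ ε ∈ B, P (μ ε) ε) ∧
      ∀ q, ∀ᶠ ε in atBot, ε ∈ B → q ≤ μ ε := by
  have hex : ∀ m : ℕ, ∃ ε : Idx, ε.1 ≤ 1 / ((m : ℝ) + 1) ∧ P m ε := fun m => by
    have hp : (0 : ℝ) < 1 / ((m : ℝ) + 1) := by positivity
    have h1 : 1 / ((m : ℝ) + 1) ≤ 1 := by
      rw [div_le_one (by positivity)]
      linarith [(Nat.cast_nonneg m : (0 : ℝ) ≤ m)]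
    obtain ⟨ε, hε, hP⟩ := frequently_atBot.1 (h m) ⟨1 / ((m : ℝ) + 1), hp, h1⟩
    exact ⟨ε, hε, hP⟩
  choose e he hP using hex
  classical
  -- only finitely many of the indices `e m ≤ 1 / (m + 1)` lie above a given one
  refine ⟨Set.range e, fun ε => if h : ∃ m, e m = ε then h.choose else 0, ?_, ?_, ?_⟩
  · refine frequently_atBot.2 fun a => ?_
    obtain ⟨m, hm⟩ := exists_nat_one_div_lt a.2.1
    exact ⟨e m, (he m).trans hm.le, m, rfl⟩
  · rintro ε h
    have h : ∃ m, e m = ε := h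
    simp only [dif_pos h]
    have := hP h.choose
    rwa [h.choose_spec] at this
  · intro q
    have h1 : ∀ᶠ ε in atBot, ∀ m ∈ Finset.range q, ε < e m :=
      (Finset.eventually_all _).2 fun m _ => eventually_lt_atBot (e m)
    filter_upwards [h1] with ε hε h
    have h : ∃ m, e m = ε := h
    simp only [dif_pos h]
    by_contra! hlt
    have := hε _ (Finset.mem_range.2 hlt)
    rw [h.choose_spec] at this
    exact lt_irrefl _ this

/-- A property that eventually holds along every representative of every point of a cube holds
uniformly on a neighbourhood `[-k_ε - ρ_ε^M, k_ε + ρ_ε^M]ⁿ` of the representing cubes. -/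
lemma eventually_forall_box {k : RC ρ ℝ} {r : Idx → ℝ} (hr : Represents r k)
    (hr0 : ∀ᶠ ε in atBot, 0 ≤ r ε) {P : ℕ → Idx → EuclideanSpace ℝ (Fin n) → Prop}
    (hmono : ∀ ε x N N', N ≤ N' → P N ε x → P N' ε x)
    (hP : ∀ x ∈ cube n k, ∀ u, RepresentsPt u x → ∃ N, ∀ᶠ ε in atBot, P N ε (u ε)) :
    ∃ M : ℕ, ∀ᶠ ε in atBot, ∀ x ∈ box n (r ε + ρ ε ^ M), P M ε x := by
  by_contra! hcon
  obtain ⟨B, μ, hB, hBP, hμ⟩ := exists_diagonal (P := fun M ε =>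
    ∃ x ∈ box n (r ε + ρ ε ^ M), ¬ P M ε x) fun m => by simpa using hcon m
  choose! b hb hbP using hBP
  classical
  -- the counterexamples, completed by `0`, represent a point of the cube
  set u : Idx → EuclideanSpace ℝ (Fin n) := fun ε => if ε ∈ B then b ε else 0 with hu
  have hubox : ∀ m : ℕ, ∀ᶠ ε in atBot, u ε ∈ box n (r ε + ρ ε ^ m) := by
    intro m
    filter_upwards [hμ m, hr0] with ε h1 h2
    by_cases hε : ε ∈ B
    · simp only [hu, if_pos hε]
      have := ρ.pow_anti ε (h1 hε)
      exact box_mono (by linarith) (hb ε hε)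
    · simp only [hu, if_neg hε]
      intro i
      simpa using add_nonneg h2 (pow_pos (ρ.pos ε) m).le
  have humod : ∀ i, Moderate ρ fun ε => u ε i := fun i => by
    obtain ⟨N, hN⟩ := hr.moderate.add (moderate_const (1 : ℝ))
    refine ⟨N, ?_⟩
    filter_upwards [hN, hubox 0] with ε h1 h2
    have := h2 i
    rw [pow_zero] at this
    exact this.trans ((le_abs_self _).trans h1)
  obtain ⟨x, hx⟩ := exists_representsPt humod
  obtain ⟨N, hN⟩ := hP x ((mem_cube_iff hx hr).2 hubox) u hx
  obtain ⟨ε, hεB, h1, h2⟩ := (hB.and_eventually (hN.and (hμ N))).exists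
  refine hbP ε hεB (hmono ε _ _ _ (h2 hεB) ?_)
  simpa only [hu, if_pos hεB] using h1

/-- Around a sharply interior point, the cube contains a ball of radius `dρ^N`; in terms of
representatives, the distance of the point to the boundary is at least `ρ_ε^N`. -/
lemma exists_pow_of_mem_sharpInterior {k : RC ρ ℝ} {r : Idx → ℝ} (hr : Represents r k)
    {y : Pt ρ n} (hy : y ∈ sharpInterior (cube n k)) {u : Idx → EuclideanSpace ℝ (Fin n)}
    (hu : RepresentsPt u y) : ∃ N : ℕ, ∀ᶠ ε in atBot, ∀ i, |u ε i| + ρ ε ^ N ≤ r ε := by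
  -- the topology of all sets that are neighbourhoods of their points in terms of representatives
  let τ : TopologicalSpace (Pt ρ n) :=
    { IsOpen := fun U => ∀ x ∈ U, ∃ N : ℕ, ∀ (z : Pt ρ n) (a b : Idx → EuclideanSpace ℝ (Fin n)),
        RepresentsPt a x → RepresentsPt b z → (∀ᶠ ε in atBot, ‖b ε - a ε‖ ≤ ρ ε ^ N) → z ∈ U
      isOpen_univ := fun x _ => ⟨0, fun _ _ _ _ _ _ => trivial⟩
      isOpen_inter := by
        rintro U V hU hV x ⟨hxU, hxV⟩
        obtain ⟨N, hN⟩ := hU x hxU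
        obtain ⟨M, hM⟩ := hV x hxV
        refine ⟨N + M, fun z a b ha hb h => ⟨hN z a b ha hb ?_, hM z a b ha hb ?_⟩⟩
        · exact h.mono fun ε hε => hε.trans (ρ.pow_anti ε (by omega))
        · exact h.mono fun ε hε => hε.trans (ρ.pow_anti ε (by omega))
      isOpen_sUnion := by
        rintro S hS x ⟨U, hUS, hxU⟩
        obtain ⟨N, hN⟩ := hS U hUS x hxU
        exact ⟨N, fun z a b ha hb h => ⟨U, hUS, hN z a b ha hb h⟩⟩ }
  have hτ : τ ≤ sharpTopology ρ n := by
    refine le_generateFrom ?_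
    rintro U ⟨c, s, hs, rfl⟩ x hx
    have hsub : ∀ {a : Idx → EuclideanSpace ℝ (Fin n)} {x : Pt ρ n}, RepresentsPt a x →
        RepresentsPt (fun ε => a ε - c.rep ε) (x - c) := fun ha i =>
      (ha i).sub (c.representsPt_rep i)
    obtain ⟨N, hN⟩ := (lt_iff_of_represents (hsub x.representsPt_rep).norm s.represents_rep).1 hx
    refine ⟨N + 2, fun z a b ha hb h => ?_⟩
    refine (lt_iff_of_represents (hsub hb).norm s.represents_rep).2 ⟨N + 1, ?_⟩
    have h1 := negligible_of_coord (u := fun ε => a ε - x.rep ε) fun i => by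
      simpa using (ha i).negligible_sub (x.representsPt_rep i)
    filter_upwards [hN, h, h1 (N + 2), ρ.eventually_mul_pow_le 3 N] with ε h2 h3 h4 h5
    have h6 : ρ ε ^ (N + 2) ≤ ρ ε ^ (N + 1) := ρ.pow_anti ε (by omega)
    have h7 : ‖b ε - c.rep ε‖ ≤ ‖b ε - a ε‖ + ‖a ε - x.rep ε‖ + ‖x.rep ε - c.rep ε‖ := by
      have := norm_add₃_le (a := b ε - a ε) (b := a ε - x.rep ε) (c := x.rep ε - c.rep ε)
      simpa using this
    linarith
  obtain ⟨U, hUK, hUo, hyU⟩ := (@mem_interior _ (sharpTopology ρ n) _ _).1 hy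
  obtain ⟨N, hN⟩ := hτ U hUo y hyU
  -- move `y` by `± dρ^N` along the `i`-th axis without leaving the cube
  have hmem : ∀ (i : Fin n) (s : ℝ), |s| = 1 →
      ∀ᶠ ε in atBot, s * u ε i + ρ ε ^ N ≤ r ε + ρ ε ^ (N + 1) := by
    intro i s hs
    have hρm : Moderate ρ fun ε => (s * ρ ε ^ N : ℝ) := by
      refine (moderate_const (1 : ℝ)).of_le fun ε => ?_
      rw [norm_mul, Real.norm_eq_abs s, hs, one_mul, norm_pow, Real.norm_of_nonneg (ρ.pos ε).le,
        norm_one]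
      exact pow_le_one₀ (ρ.pos ε).le (ρ.le_one ε)
    have hbm : ∀ j, Moderate ρ fun ε =>
        (u ε + EuclideanSpace.single i (s * ρ ε ^ N : ℝ)) j := by
      intro j
      rcases eq_or_ne j i with rfl | hj
      · simpa using (hu j).moderate.add hρm
      · simpa [hj] using (hu j).moderate
    obtain ⟨z, hz⟩ := exists_representsPt hbm
    have hzK := hUK (hN z u _ hu hz (Eventually.of_forall fun ε => by
      simp [hs, abs_of_pos (ρ.pos ε)]))
    filter_upwards [(mem_cube_iff hz hr).1 hzK (N + 1)] with ε hε
    have h1 := hε i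
    have h2 : s * s = 1 := by rw [← abs_mul_abs_self, hs, one_mul]
    have h3 : s * u ε i + ρ ε ^ N = s * (u ε i + s * ρ ε ^ N) := by
      linear_combination -ρ ε ^ N * h2
    simp only [PiLp.add_apply, PiLp.single_apply, if_true] at h1
    rw [h3]
    refine (le_abs_self _).trans ?_
    rwa [abs_mul, hs, one_mul]
  refine ⟨N + 1, ?_⟩
  filter_upwards [eventually_all.2 fun i => hmem i 1 (by simp),
    eventually_all.2 fun i => hmem i (-1) (by simp), ρ.eventually_mul_pow_le 2 N] with ε h1 h2 h3 i
  have := h1 i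
  have := h2 i
  rcases abs_cases (u ε i) with ⟨h, _⟩ | ⟨h, _⟩ <;> rw [h] <;> linarith

/-! ### The integral over a cube -/

lemma abs_clamp_sub_le {r d x : ℝ} (hr : 0 ≤ r) (hd : 0 ≤ d) (hx : |x| ≤ r + d) :
    |max (-r) (min r x) - x| ≤ d := by
  rw [abs_le] at hx ⊢
  grind

/-- The cube `[-k, k]ⁿ` is the internal set generated by the cubes `[-k_ε, k_ε]ⁿ`. -/
lemma cube_eq_internalSet {k : RC ρ ℝ} {r : Idx → ℝ} (hr : Represents r k)
    (hr0 : ∀ᶠ ε in atBot, 0 ≤ r ε) : cube n k = internalSet ρ fun ε => box n (r ε) := by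
  ext x
  constructor
  · intro hx
    have hu := x.representsPt_rep
    have hb := (mem_cube_iff hu hr).1 hx
    -- clamp the coordinates of a representative to `[-r, r]`
    refine ⟨fun ε => WithLp.toLp 2 fun i => max (-r ε) (min (r ε) (x.rep ε i)),
      hu.of_negligible fun i m => ?_, ?_⟩
    · filter_upwards [hb m, hr0] with ε h1 h2
      exact abs_clamp_sub_le h2 (pow_pos (ρ.pos ε) m).le (h1 i)
    · filter_upwards [hr0] with ε h2 i
      exact abs_le.2 ⟨le_max_left _ _, max_le (by linarith) (min_le_left _ _)⟩
  · rintro ⟨u, hu, h⟩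
    refine (mem_cube_iff hu hr).2 fun m => ?_
    filter_upwards [h] with ε hε
    exact box_mono (by linarith [pow_pos (ρ.pos ε) m]) hε

lemma exists_eventually_le_inv_pow {u : Idx → ℝ} (hu : Moderate ρ u) :
    ∃ N : ℕ, ∀ᶠ ε in atBot, u ε ≤ (ρ ε ^ N)⁻¹ :=
  hu.imp fun _ h => h.mono fun _ hε => (le_abs_self _).trans hε

lemma isCompactRep_cube {k : RC ρ ℝ} {r : Idx → ℝ} (hr : Represents r k)
    (hr0 : ∀ᶠ ε in atBot, 0 ≤ r ε) : IsCompactRep (cube n k) fun ε => box n (r ε) := by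
  refine ⟨cube_eq_internalSet hr hr0, fun ε => isCompact_box _, ?_⟩
  obtain ⟨N, hN⟩ := exists_eventually_le_inv_pow ((moderate_const (n : ℝ)).mul hr.moderate)
  refine ⟨N, ?_⟩
  filter_upwards [hN] with ε h x hx
  refine (norm_le_sum_coord x).trans ((Finset.sum_le_sum fun i _ => hx i).trans ?_)
  simpa using h

lemma zero_mem_cube {k : RC ρ ℝ} {r : Idx → ℝ} (hr : Represents r k)
    (hr0 : ∀ᶠ ε in atBot, 0 ≤ r ε) : (0 : Pt ρ n) ∈ cube n k := by
  refine (mem_cube_iff (u := fun _ => 0) (fun i => represents_zero) hr).2 fun m => ?_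
  filter_upwards [hr0] with ε h i
  simpa using add_nonneg h (pow_pos (ρ.pos ε) m).le

/-- A sharply bounded net of compact sets generating a cube lies in arbitrarily small
neighbourhoods of the representing cubes. -/
lemma IsCompactRep.eventually_subset_box {k : RC ρ ℝ} {r : Idx → ℝ} (hr : Represents r k)
    (hr0 : ∀ᶠ ε in atBot, 0 ≤ r ε) {A : Idx → Set (EuclideanSpace ℝ (Fin n))}
    (hA : IsCompactRep (cube n k) A) (m : ℕ) :
    ∀ᶠ ε in atBot, A ε ⊆ box n (r ε + ρ ε ^ m) := by
  obtain ⟨hKA, -, N, hN⟩ := hA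
  obtain ⟨v, -, hv⟩ : (0 : Pt ρ n) ∈ internalSet ρ A := hKA ▸ zero_mem_cube hr hr0
  by_contra hcon
  rw [not_eventually] at hcon
  classical
  -- points of `A ε` outside the boxes, where there are any, would represent a point of the cube
  set u : Idx → EuclideanSpace ℝ (Fin n) := fun ε =>
    if h : A ε ⊆ box n (r ε + ρ ε ^ m) then v ε else (Set.not_subset.1 h).choose with hu
  have huA : ∀ᶠ ε in atBot, u ε ∈ A ε := by
    filter_upwards [hv] with ε h1
    by_cases h : A ε ⊆ box n (r ε + ρ ε ^ m)
    · simpa only [hu, dif_pos h] using h1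
    · simpa only [hu, dif_neg h] using (Set.not_subset.1 h).choose_spec.1
  have humod : ∀ i, Moderate ρ fun ε => u ε i := fun i =>
    ⟨N, by filter_upwards [hN, huA] with ε h1 h2 using (PiLp.norm_apply_le _ _).trans (h1 _ h2)⟩
  obtain ⟨x, hx⟩ := exists_representsPt humod
  have hxK : x ∈ cube n k := hKA ▸ ⟨u, hx, huA⟩
  obtain ⟨ε, h1, h2⟩ := (hcon.and_eventually ((mem_cube_iff hx hr).1 hxK m)).exists
  refine (Set.not_subset.1 h1).choose_spec.2 ?_
  simpa only [hu, dif_neg h1] using h2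

/-- The representing cubes lie in arbitrarily small neighbourhoods of any sharply bounded net of
compact sets generating the cube. -/
lemma IsCompactRep.eventually_box_subset {k : RC ρ ℝ} {r : Idx → ℝ} (hr : Represents r k)
    (hr0 : ∀ᶠ ε in atBot, 0 ≤ r ε) {A : Idx → Set (EuclideanSpace ℝ (Fin n))}
    (hA : IsCompactRep (cube n k) A) (m : ℕ) :
    ∀ᶠ ε in atBot, box n (r ε) ⊆ Metric.cthickening (ρ ε ^ m) (A ε) := by
  obtain ⟨hKA, -, -⟩ := hA
  by_contra hcon
  rw [not_eventually] at hcon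
  classical
  set u : Idx → EuclideanSpace ℝ (Fin n) := fun ε =>
    if h : box n (r ε) ⊆ Metric.cthickening (ρ ε ^ m) (A ε) then 0
    else (Set.not_subset.1 h).choose with hu
  have hur : ∀ᶠ ε in atBot, u ε ∈ box n (r ε) := by
    filter_upwards [hr0] with ε h0
    by_cases h : box n (r ε) ⊆ Metric.cthickening (ρ ε ^ m) (A ε)
    · simp only [hu, dif_pos h]
      exact fun i => by simpa using h0
    · simp only [hu, dif_neg h]
      exact (Set.not_subset.1 h).choose_spec.1
  have humod : ∀ i, Moderate ρ fun ε => u ε i := fun i => by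
    obtain ⟨N, hN⟩ := hr.moderate
    exact ⟨N, by filter_upwards [hN, hur] with ε h1 h2 using
      (h2 i).trans ((le_abs_self _).trans h1)⟩
  obtain ⟨x, hx⟩ := exists_representsPt humod
  have hxK : x ∈ cube n k := by
    refine (mem_cube_iff hx hr).2 fun m' => ?_
    filter_upwards [hur] with ε h
    exact box_mono (by linarith [pow_pos (ρ.pos ε) m']) h
  obtain ⟨v, hv, hvA⟩ : x ∈ internalSet ρ A := hKA ▸ hxK
  have huv := negligible_of_coord (u := fun ε => u ε - v ε) fun i => by
    simpa using (hx i).negligible_sub (hv i)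
  obtain ⟨ε, h1, h2, h3⟩ := (hcon.and_eventually (hvA.and (huv m))).exists
  refine (Set.not_subset.1 h1).choose_spec.2 ?_
  have h4 : u ε ∈ Metric.cthickening (ρ ε ^ m) (A ε) :=
    Metric.mem_cthickening_of_dist_le _ _ _ _ h2 (by rwa [dist_eq_norm])
  simpa only [hu, dif_neg h1] using h4

lemma cthickening_subset_box {A : Set (EuclideanSpace ℝ (Fin n))} (hA : IsCompact A) {r d : ℝ}
    (hd : 0 ≤ d) (h : A ⊆ box n r) : Metric.cthickening d A ⊆ box n (r + d) := by
  intro x hx i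
  rw [hA.cthickening_eq_biUnion_closedBall hd] at hx
  simp only [Set.mem_iUnion, Metric.mem_closedBall, dist_eq_norm] at hx
  obtain ⟨z, hz, hxz⟩ := hx
  have h1 : |x i - z i| ≤ d := (PiLp.norm_apply_le (x - z) i).trans hxz
  have h2 := abs_add_le (x i - z i) (z i)
  rw [sub_add_cancel] at h2
  linarith [h hz i]

/-- Representatives of an integrable function on a cube are moderate, uniformly on a
neighbourhood of the representing cubes. -/
lemma RepresentsIntegrable.exists_eventually_bound {k : RC ρ ℝ} {r : Idx → ℝ}
    (hr : Represents r k) (hr0 : ∀ᶠ ε in atBot, 0 ≤ r ε) {f : Pt ρ n → RC ρ ℂ}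
    {F : Idx → EuclideanSpace ℝ (Fin n) → ℂ} (hF : RepresentsIntegrable (cube n k) f F) :
    ∃ N : ℕ, ∀ᶠ ε in atBot, ContinuousOn (F ε) (box n (r ε + ρ ε ^ N)) ∧
      ∀ x ∈ box n (r ε + ρ ε ^ N), ‖F ε x‖ ≤ (ρ ε ^ N)⁻¹ := by
  obtain ⟨Ω, -, hFΩ, hKΩ, hFf⟩ := hF
  obtain ⟨N, hN⟩ := eventually_forall_box hr hr0
    (P := fun N ε x => x ∈ Ω ε ∧ ‖F ε x‖ ≤ (ρ ε ^ N)⁻¹)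
    (fun ε x N N' hNN' h => ⟨h.1, h.2.trans (ρ.inv_pow_mono ε hNN')⟩)
    (fun x hx u hu => by
      obtain ⟨N, hN⟩ := (hFf x hx u hu).moderate
      exact ⟨N, (hKΩ hx u hu).and hN⟩)
  refine ⟨N, hN.mono fun ε h => ⟨(hFΩ ε).mono fun x hx => (h x hx).1, fun x hx => (h x hx).2⟩⟩

lemma volume_real_box_sub_le {r d a : ℝ} (hr : 0 ≤ r) (hd : 0 ≤ d) (ha : r + d ≤ a)
    (ha1 : 1 ≤ a) :
    volume.real (box n (r + d)) - volume.real (box n r) ≤ 2 * n * 2 ^ n * d * a ^ n := by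
  rw [volume_real_box (by positivity), volume_real_box hr]
  have h1 := abs_pow_sub_pow_le (2 * (r + d)) (2 * r) n
  have h2 : |2 * (r + d) - 2 * r| = 2 * d := by
    rw [show 2 * (r + d) - 2 * r = 2 * d by ring, abs_of_nonneg (by positivity)]
  have h3 : max |2 * (r + d)| |2 * r| ≤ 2 * a := by
    rw [abs_of_nonneg (by positivity), abs_of_nonneg (by positivity)]
    exact max_le (by linarith) (by linarith)
  have h4 : max |2 * (r + d)| |2 * r| ^ (n - 1) ≤ (2 * a) ^ n :=
    (pow_le_pow_left₀ (by positivity) h3 _).trans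
      (pow_le_pow_right₀ (by linarith) (Nat.sub_le n 1))
  rw [h2] at h1
  calc _ ≤ 2 * d * n * max |2 * (r + d)| |2 * r| ^ (n - 1) := (le_abs_self _).trans h1
    _ ≤ 2 * d * n * (2 * a) ^ n := by gcongr
    _ = _ := by
      rw [mul_pow]
      ring

/-- The integrals over shrinking neighbourhoods of any sharply bounded net of compact sets
generating a cube, of any representative of `f`, approach the integrals of any other
representative over the representing cubes. -/
lemma exists_eventually_norm_integral_sub_le {k : RC ρ ℝ} {r : Idx → ℝ} (hr : Represents r k)
    (hr0 : ∀ᶠ ε in atBot, 0 ≤ r ε) {f : Pt ρ n → RC ρ ℂ}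
    {F F' : Idx → EuclideanSpace ℝ (Fin n) → ℂ} (hF : RepresentsIntegrable (cube n k) f F)
    (hF' : RepresentsIntegrable (cube n k) f F') {A : Idx → Set (EuclideanSpace ℝ (Fin n))}
    (hA : IsCompactRep (cube n k) A) (q : ℕ) :
    ∃ M : ℕ, ∀ m ≥ M, ∀ᶠ ε in atBot,
      ‖(∫ x in Metric.cthickening (ρ ε ^ m) (A ε), F' ε x) - ∫ x in box n (r ε), F ε x‖ ≤
        ρ ε ^ q := by
  obtain ⟨N₁, hN₁⟩ := hF.exists_eventually_bound hr hr0
  obtain ⟨N, hN⟩ := hF'.exists_eventually_bound hr hr0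
  obtain ⟨R, hR⟩ := exists_eventually_le_inv_pow (hr.moderate.add (moderate_const (1 : ℝ)))
  -- `F` and `F'` differ by a negligible net, uniformly
  obtain ⟨M₁, hM₁⟩ := eventually_forall_box hr hr0
    (P := fun _ ε x => ‖F' ε x - F ε x‖ ≤ ρ ε ^ (q + 1 + R * n)) (fun _ _ _ _ _ h => h)
    (fun x hx u hu => by
      obtain ⟨_, _, _, _, h⟩ := hF
      obtain ⟨_, _, _, _, h'⟩ := hF'
      exact ⟨0, (h' x hx u hu).negligible_sub (h x hx u hu) (q + 1 + R * n)⟩)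
  refine ⟨q + 1 + N + R * n + 1, fun m hm => ?_⟩
  filter_upwards [hN₁, hN, hR, hM₁, hr0, hA.eventually_subset_box hr hr0 m,
    hA.eventually_box_subset hr hr0 m, ρ.eventually_mul_pow_le (2 * n * 2 ^ n * 2 + 2 ^ n) q,
    ρ.eventually_mul_pow_le 2 N, ρ.eventually_mul_pow_le 2 0]
    with ε hε₁ hε hεR hεM hr0 hA1 hA2 hc h2N h2
  have hρ := ρ.pos ε
  set T := Metric.cthickening (ρ ε ^ m) (A ε) with hT
  have hd : 2 * ρ ε ^ m ≤ 1 := by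
    have h3 : ρ ε ^ m ≤ ρ ε ^ (0 + 1) := ρ.pow_anti ε (by omega)
    rw [pow_zero] at h2
    linarith
  have hdN : 2 * ρ ε ^ m ≤ ρ ε ^ N := by
    have : ρ ε ^ m ≤ ρ ε ^ (N + 1) := ρ.pow_anti ε (by omega)
    linarith
  have hTbox : T ⊆ box n (r ε + 2 * ρ ε ^ m) := by
    refine (cthickening_subset_box (hA.2.1 ε) (pow_pos hρ m).le hA1).trans (box_mono ?_)
    linarith
  have hTN : T ⊆ box n (r ε + ρ ε ^ N) := hTbox.trans (box_mono (by linarith))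
  have hTc : IsCompact T := (hA.2.1 ε).cthickening
  have hF'T : IntegrableOn (F' ε) T := (hε.1.mono hTN).integrableOn_compact hTc
  -- `box n (r ε) ⊆ T ⊆ box n (r ε + 2 ρ_ε^m)`: the difference of the sets has small volume, and
  -- on the inner box the integrands nearly agree
  have hFb : IntegrableOn (F ε) (box n (r ε)) :=
    (hε₁.1.mono (box_mono (by linarith [pow_pos hρ N₁]))).integrableOn_compact (isCompact_box _)
  have hsplit : (∫ x in T, F' ε x) - ∫ x in box n (r ε), F ε x =
      (∫ x in T \ box n (r ε), F' ε x) + ∫ x in box n (r ε), (F' ε x - F ε x) := by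
    rw [setIntegral_sdiff (measurableSet_box _) hF'T hA2, integral_sub (hF'T.mono_set hA2) hFb]
    ring
  have ha1 : 1 ≤ (ρ ε ^ R)⁻¹ := (one_le_inv₀ (pow_pos hρ R)).2 (pow_le_one₀ hρ.le (ρ.le_one ε))
  have hvol : volume.real (T \ box n (r ε)) ≤
      2 * n * 2 ^ n * (2 * ρ ε ^ m) * (ρ ε ^ R)⁻¹ ^ n := by
    refine le_trans ?_ (volume_real_box_sub_le hr0 (by positivity) (by linarith) ha1)
    rw [← measureReal_sdiff (box_mono (by linarith [pow_pos hρ m])) (measurableSet_box _)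
      (isCompact_box _).measure_lt_top.ne]
    exact measureReal_mono (Set.sdiff_subset_sdiff_left hTbox)
      ((measure_mono Set.sdiff_subset).trans_lt (isCompact_box _).measure_lt_top).ne
  have h1 : ‖∫ x in T \ box n (r ε), F' ε x‖ ≤
      (ρ ε ^ N)⁻¹ * (2 * n * 2 ^ n * (2 * ρ ε ^ m) * (ρ ε ^ R)⁻¹ ^ n) := by
    refine (norm_setIntegral_le_of_norm_le_const
      ((measure_mono Set.sdiff_subset).trans_lt hTc.measure_lt_top)
      fun x hx => hε.2 x (hTN hx.1)).trans ?_
    gcongr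
  have h2 : ‖∫ x in box n (r ε), (F' ε x - F ε x)‖ ≤
      ρ ε ^ (q + 1 + R * n) * (2 * (ρ ε ^ R)⁻¹) ^ n := by
    refine (norm_setIntegral_le_of_norm_le_const (isCompact_box _).measure_lt_top
      fun x hx => hεM x (box_mono (by linarith [pow_pos hρ M₁]) hx)).trans ?_
    rw [volume_real_box hr0]
    gcongr
    linarith
  have e1 : (ρ ε ^ N)⁻¹ * (2 * n * 2 ^ n * (2 * ρ ε ^ m) * (ρ ε ^ R)⁻¹ ^ n) ≤
      2 * n * 2 ^ n * 2 * ρ ε ^ (q + 1) := by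
    have h3 : ρ ε ^ m ≤ ρ ε ^ (q + 1) * ρ ε ^ N * (ρ ε ^ R) ^ n := by
      rw [← pow_mul, ← pow_add, ← pow_add]
      exact ρ.pow_anti ε (by omega)
    calc _ ≤ (ρ ε ^ N)⁻¹ * (2 * n * 2 ^ n * (2 * (ρ ε ^ (q + 1) * ρ ε ^ N * (ρ ε ^ R) ^ n)) *
          (ρ ε ^ R)⁻¹ ^ n) := by gcongr
      _ = _ := by
        rw [inv_pow]
        field_simp
  have e2 : ρ ε ^ (q + 1 + R * n) * (2 * (ρ ε ^ R)⁻¹) ^ n = 2 ^ n * ρ ε ^ (q + 1) := by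
    rw [mul_pow, inv_pow, ← pow_mul, pow_add _ (q + 1)]
    field_simp
  rw [hsplit]
  refine (norm_add_le _ _).trans ?_
  linarith

/-- The integral of `f` over the cube `[-k, k]ⁿ` is computed by any representative of `f` and any
representative of `k`. -/
theorem represents_integral_cube {k : RC ρ ℝ} {r : Idx → ℝ} (hr : Represents r k)
    (hr0 : ∀ᶠ ε in atBot, 0 ≤ r ε) {f : Pt ρ n → RC ρ ℂ}
    {F : Idx → EuclideanSpace ℝ (Fin n) → ℂ} (hF : RepresentsIntegrable (cube n k) f F) :
    Represents (fun ε => ∫ x in box n (r ε), F ε x) (integral (cube n k) f) := by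
  have hmod : Moderate ρ fun ε => ∫ x in box n (r ε), F ε x := by
    obtain ⟨N, hN⟩ := hF.exists_eventually_bound hr hr0
    obtain ⟨R, hR⟩ := exists_eventually_le_inv_pow (hr.moderate.add hr.moderate)
    refine ⟨N + R * n, ?_⟩
    filter_upwards [hN, hR, hr0] with ε h1 h2 h3
    have hρ := ρ.pos ε
    refine (norm_setIntegral_le_of_norm_le_const (isCompact_box _).measure_lt_top
      fun x hx => h1.2 x (box_mono (by linarith [pow_pos hρ N]) hx)).trans ?_
    rw [volume_real_box h3, pow_add, mul_inv, pow_mul, ← inv_pow (ρ ε ^ R)]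
    gcongr
    linarith
  have hrep := Represents.ofNet hmod
  have hex : ∃ v, IsIntegral (cube n k) f v := by
    refine ⟨RC.ofNet ρ fun ε => ∫ x in box n (r ε), F ε x, _, F, isCompactRep_cube hr hr0, hF,
      fun q => ?_⟩
    obtain ⟨M, hM⟩ :=
      exists_eventually_norm_integral_sub_le hr hr0 hF hF (isCompactRep_cube hr hr0) q
    refine ⟨M, fun m hm => ?_⟩
    have hdm : Moderate ρ fun ε => (∫ x in Metric.cthickening (ρ ε ^ m) (box n (r ε)), F ε x) -
        ∫ x in box n (r ε), F ε x :=
      ⟨0, (hM m hm).mono fun ε h => h.trans (by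
        simpa using pow_le_one₀ (ρ.pos ε).le (ρ.le_one ε))⟩
    have hm' : Moderate ρ fun ε => ∫ x in Metric.cthickening (ρ ε ^ m) (box n (r ε)), F ε x := by
      simpa using hdm.add hmod
    exact ⟨_, Represents.ofNet hm', abs_sub_le_d_pow (Represents.ofNet hm') hrep (hM m hm)⟩
  rw [integral, dif_pos hex]
  obtain ⟨A, F', hA, hF', hlim⟩ := hex.choose_spec
  obtain ⟨v, hv⟩ := exists_represents hex.choose
  refine hv.of_negligible (negligible_of_le_mul 3 fun q => ?_)
  obtain ⟨M, hM⟩ := hlim q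
  obtain ⟨M', hM'⟩ := exists_eventually_norm_integral_sub_le hr hr0 hF hF' hA q
  obtain ⟨w, hw, hwv⟩ := hM (max M M') (le_max_left _ _)
  filter_upwards [eventually_norm_sub_le_of_abs_sub_le hw hv hwv,
    hM' (max M M') (le_max_right _ _)] with ε h1 h2
  rw [norm_sub_rev] at h2
  refine (norm_sub_le_norm_sub_add_norm_sub _ _ _).trans ((add_le_add h2 h1).trans_eq ?_)
  ring

/-! ### Representatives of hyperfinite Fourier transforms -/

lemma RepresentsIntegrable.const_smul {K : Set (Pt ρ n)} {f : Pt ρ n → RC ρ ℂ}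
    {F : Idx → EuclideanSpace ℝ (Fin n) → ℂ} (hF : RepresentsIntegrable K f F) (c : ℝ) :
    RepresentsIntegrable K (fun x => c • f x) fun ε x => (c : ℂ) * F ε x := by
  obtain ⟨Ω, hΩ, hFΩ, hKΩ, h⟩ := hF
  refine ⟨Ω, hΩ, fun ε => continuousOn_const.mul (hFΩ ε), hKΩ, fun x hx u hu => ?_⟩
  simpa only [Complex.real_smul] using (h x hx u hu).smul c

lemma represents_integral_mul_expI {k : RC ρ ℝ} {r : Idx → ℝ} (hr : Represents r k)
    (hr0 : ∀ᶠ ε in atBot, 0 ≤ r ε) {f : Pt ρ n → RC ρ ℂ}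
    {F : Idx → EuclideanSpace ℝ (Fin n) → ℂ} (hF : RepresentsIntegrable (cube n k) f F) (σ : ℝ)
    {w : Pt ρ n} {v : Idx → EuclideanSpace ℝ (Fin n)} (hv : RepresentsPt v w) :
    Represents (fun ε => boxFourier (r ε) σ (F ε) (v ε))
      (integral (cube n k) fun x => f x * RC.expI (σ • (x ⬝ᵥ w))) := by
  refine represents_integral_cube hr hr0 ?_
  obtain ⟨Ω, hΩ, hFΩ, hKΩ, h⟩ := hF
  refine ⟨Ω, hΩ, fun ε => (hFΩ ε).mul (Continuous.continuousOn (by fun_prop)), hKΩ,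
    fun x hx u hu => ?_⟩
  exact (h x hx u hu).mul ((hu.dotProduct hv).smul σ).expI

lemma represents_hft {k : RC ρ ℝ} {r : Idx → ℝ} (hr : Represents r k)
    (hr0 : ∀ᶠ ε in atBot, 0 ≤ r ε) {f : Pt ρ n → RC ρ ℂ}
    {F : Idx → EuclideanSpace ℝ (Fin n) → ℂ} (hF : RepresentsIntegrable (cube n k) f F)
    {w : Pt ρ n} {v : Idx → EuclideanSpace ℝ (Fin n)} (hv : RepresentsPt v w) :
    Represents (fun ε => boxFourier (r ε) (-1) (F ε) (v ε)) (hft k f w) := by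
  simpa [hft] using represents_integral_mul_expI hr hr0 hF (-1) hv

lemma represents_invHft {k : RC ρ ℝ} {r : Idx → ℝ} (hr : Represents r k)
    (hr0 : ∀ᶠ ε in atBot, 0 ≤ r ε) {f : Pt ρ n → RC ρ ℂ}
    {F : Idx → EuclideanSpace ℝ (Fin n) → ℂ} (hF : RepresentsIntegrable (cube n k) f F)
    {x : Pt ρ n} {v : Idx → EuclideanSpace ℝ (Fin n)} (hv : RepresentsPt v x) :
    Represents (fun ε => (((2 * Real.pi) ^ n : ℝ) : ℂ)⁻¹ * boxFourier (r ε) 1 (F ε) (v ε))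
      (invHft k f x) := by
  have h := (represents_integral_mul_expI hr hr0 hF 1 hv).smul (((2 * Real.pi) ^ n)⁻¹)
  simpa only [Complex.real_smul, one_smul, Complex.ofReal_inv, dotProduct_comm _ x, invHft] using h

/-- A function `g` whose values are given by the partial Fourier transforms of a representative
of `f` is represented by them on every set `K`, so that it can be integrated in turn. -/
lemma RepresentsIntegrable.boxFourier {k : RC ρ ℝ} {r : Idx → ℝ} (hr : Represents r k)
    (hr0 : ∀ᶠ ε in atBot, 0 ≤ r ε) {f : Pt ρ n → RC ρ ℂ}
    {F : Idx → EuclideanSpace ℝ (Fin n) → ℂ} (hF : RepresentsIntegrable (cube n k) f F) (σ : ℝ)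
    {g : Pt ρ n → RC ρ ℂ} (hg : ∀ w v, RepresentsPt v w →
      Represents (fun ε => DirichletKernel.boxFourier (r ε) σ (F ε) (v ε)) (g w))
    (K : Set (Pt ρ n)) :
    RepresentsIntegrable K g fun ε => DirichletKernel.boxFourier (r ε) σ (F ε) := by
  -- the transform is continuous for small `ε` only, so the domain is empty for the other `ε`
  refine ⟨fun ε => {_w | ContinuousOn (F ε) (box n (r ε))}, fun ε => isOpen_const,
    fun ε w hw => (continuous_boxFourier σ hw).continuousWithinAt, fun w _ v _ => ?_,
    fun w _ v hv => hg w v hv⟩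
  obtain ⟨N, hN⟩ := hF.exists_eventually_bound hr hr0
  filter_upwards [hN] with ε h
  exact h.1.mono (box_mono (by linarith [pow_pos (ρ.pos ε) N]))

lemma represents_invHft_hft {k h : RC ρ ℝ} {r s : Idx → ℝ} (hr : Represents r k)
    (hr0 : ∀ᶠ ε in atBot, 0 ≤ r ε) (hs : Represents s h) (hs0 : ∀ᶠ ε in atBot, 0 ≤ s ε)
    {f : Pt ρ n → RC ρ ℂ} {F : Idx → EuclideanSpace ℝ (Fin n) → ℂ}
    (hF : RepresentsIntegrable (cube n k) f F) {y : Pt ρ n}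
    {v : Idx → EuclideanSpace ℝ (Fin n)} (hv : RepresentsPt v y) :
    Represents (fun ε => (((2 * Real.pi) ^ n : ℝ) : ℂ)⁻¹ *
      boxFourier (s ε) 1 (boxFourier (r ε) (-1) (F ε)) (v ε)) (invHft h (hft k f) y) :=
  represents_invHft hs hs0 (hF.boxFourier hr hr0 (-1)
    (fun _ _ hv => represents_hft hr hr0 hF hv) _) hv

lemma represents_hft_invHft {k h : RC ρ ℝ} {r s : Idx → ℝ} (hr : Represents r k)
    (hr0 : ∀ᶠ ε in atBot, 0 ≤ r ε) (hs : Represents s h) (hs0 : ∀ᶠ ε in atBot, 0 ≤ s ε)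
    {f : Pt ρ n → RC ρ ℂ} {F : Idx → EuclideanSpace ℝ (Fin n) → ℂ}
    (hF : RepresentsIntegrable (cube n k) f F) {y : Pt ρ n}
    {v : Idx → EuclideanSpace ℝ (Fin n)} (hv : RepresentsPt v y) :
    Represents (fun ε => (((2 * Real.pi) ^ n : ℝ) : ℂ)⁻¹ *
      boxFourier (s ε) (-1) (boxFourier (r ε) 1 (F ε)) (v ε)) (hft h (invHft k f) y) := by
  have h1 : RepresentsIntegrable (cube n h)
      (fun w => integral (cube n k) fun x => f x * RC.expI ((1 : ℝ) • (x ⬝ᵥ w)))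
      fun ε => boxFourier (r ε) 1 (F ε) :=
    hF.boxFourier hr hr0 1 (fun _ _ hv => represents_integral_mul_expI hr hr0 hF 1 hv) _
  have h2 := h1.const_smul (((2 * Real.pi) ^ n)⁻¹)
  have h3 : (fun w => ((2 * Real.pi) ^ n)⁻¹ •
      integral (cube n k) fun x => f x * RC.expI ((1 : ℝ) • (x ⬝ᵥ w))) = invHft k f := by
    funext w
    simp only [invHft, one_smul, dotProduct_comm _ w]
  rw [h3] at h2
  have h4 := represents_hft hs hs0 h2 hv
  simpa only [boxFourier_const_mul, Complex.ofReal_inv] using h4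

/-! ### Fourier inversion -/

lemma exists_eventually_bound_partialDeriv {k : RC ρ ℝ} {r : Idx → ℝ} (hr : Represents r k)
    (hr0 : ∀ᶠ ε in atBot, 0 ≤ r ε) {Ω : Idx → Set (EuclideanSpace ℝ (Fin n))}
    {F : Idx → EuclideanSpace ℝ (Fin n) → ℂ} (hKΩ : cube n k ⊆ stronglyInternalSet ρ Ω)
    (hmod : ∀ x ∈ cube n k, ∀ u, RepresentsPt u x → ∀ (j : ℕ) (i : Fin j → Fin n),
      Moderate ρ fun ε => partialDeriv i (F ε) (u ε)) :
    ∃ N : ℕ, ∀ᶠ ε in atBot, ∀ x ∈ box n (r ε), x ∈ Ω ε ∧ ‖F ε x‖ ≤ (ρ ε ^ N)⁻¹ ∧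
      ∀ i, ‖partialDeriv ![i] (F ε) x‖ ≤ (ρ ε ^ N)⁻¹ := by
  obtain ⟨N, hN⟩ := eventually_forall_box hr hr0
    (P := fun N ε x => x ∈ Ω ε ∧ ‖F ε x‖ ≤ (ρ ε ^ N)⁻¹ ∧
      ∀ i, ‖partialDeriv ![i] (F ε) x‖ ≤ (ρ ε ^ N)⁻¹)
    (fun ε x N N' hNN' h => ⟨h.1, h.2.1.trans (ρ.inv_pow_mono ε hNN'),
      fun i => (h.2.2 i).trans (ρ.inv_pow_mono ε hNN')⟩)
    (fun x hx u hu => by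
      obtain ⟨N₀, hN₀⟩ := hmod x hx u hu 0 Fin.elim0
      choose N hN using fun i => hmod x hx u hu 1 ![i]
      refine ⟨N₀ + ∑ i, N i, ?_⟩
      filter_upwards [hKΩ hx u hu, hN₀, eventually_all.2 hN] with ε h1 h2 h3
      refine ⟨h1, ?_, fun i => (h3 i).trans (ρ.inv_pow_mono ε ?_)⟩
      · simp only [partialDeriv, iteratedFDeriv_zero_apply] at h2
        exact h2.trans (ρ.inv_pow_mono ε (by omega))
      · have := Finset.single_le_sum (f := N) (fun i _ => Nat.zero_le _) (Finset.mem_univ i)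
        omega)
  exact ⟨N, hN.mono fun ε h x hx => h x (box_mono (by linarith [pow_pos (ρ.pos ε) N]) hx)⟩

/-- Fourier inversion for representatives, with a common bound for both signs: if `s_ε` dominates
a large enough power of `ρ_ε⁻¹`, the error is at most `ρ_ε^q`. -/
lemma exists_eventually_norm_boxFourier_boxFourier_sub_le {k : RC ρ ℝ} {r : Idx → ℝ}
    (hr : Represents r k) (hr0 : ∀ᶠ ε in atBot, 0 ≤ r ε)
    {Ω : Idx → Set (EuclideanSpace ℝ (Fin n))} {F : Idx → EuclideanSpace ℝ (Fin n) → ℂ}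
    (hΩ : ∀ ε, IsOpen (Ω ε)) (hF : ∀ ε, ContDiffOn ℝ ∞ (F ε) (Ω ε))
    (hKΩ : cube n k ⊆ stronglyInternalSet ρ Ω)
    (hmod : ∀ x ∈ cube n k, ∀ u, RepresentsPt u x → ∀ (j : ℕ) (i : Fin j → Fin n),
      Moderate ρ fun ε => partialDeriv i (F ε) (u ε))
    {y : Pt ρ n} (hy : y ∈ sharpInterior (cube n k)) {v : Idx → EuclideanSpace ℝ (Fin n)}
    (hv : RepresentsPt v y) (q : ℕ) :
    ∃ S : ℕ, ∀ s : Idx → ℝ, (∀ᶠ ε in atBot, (ρ ε ^ S)⁻¹ ≤ s ε) →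
      ∀ σ : ℝ, σ = 1 ∨ σ = -1 → ∀ᶠ ε in atBot,
        ‖(((2 * Real.pi) ^ n : ℝ) : ℂ)⁻¹ *
          boxFourier (s ε) σ (boxFourier (r ε) (-σ) (F ε)) (v ε) - F ε (v ε)‖ ≤ ρ ε ^ q := by
  obtain ⟨N, hN⟩ := exists_eventually_bound_partialDeriv hr hr0 hKΩ hmod
  obtain ⟨R, hR⟩ := exists_eventually_le_inv_pow (hr.moderate.add (moderate_const (1 : ℝ)))
  obtain ⟨D, hD⟩ := exists_pow_of_mem_sharpInterior hr hy hv
  obtain ⟨c, hc0, hc⟩ := exists_rate_le n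
  refine ⟨2 * (N + R + D + q + 1), fun s hs σ hσ => ?_⟩
  filter_upwards [hN, hR, hD, hs, hr0, ρ.eventually_mul_pow_le c q] with ε h1 h2 h3 h4 h5 h6
  have hρ := ρ.pos ε
  have hs1 : 1 ≤ s ε :=
    ((one_le_inv₀ (pow_pos hρ _)).2 (pow_le_one₀ hρ.le (ρ.le_one ε))).trans h4
  have hs2 : (√(s ε))⁻¹ ≤ ρ ε ^ (N + R + D + q + 1) := by
    refine inv_le_of_inv_le₀ (pow_pos hρ _) (Real.le_sqrt_of_sq_le ?_)
    rwa [inv_pow, ← pow_mul, mul_comm]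
  refine (norm_boxFourier_boxFourier_sub_le (hΩ ε) (hF ε) h5 (fun x hx => (h1 x hx).1)
    (by linarith) (pow_pos hρ D).le h3 (by positivity) (fun x hx => (h1 x hx).2.1)
    (fun x hx => (h1 x hx).2.2) hσ).trans ?_
  refine (hc _ _ _ _ _ hs1 h5 h2 (pow_pos hρ D) (pow_le_one₀ hρ.le (ρ.le_one ε))
    (by positivity)).trans ?_
  calc _ ≤ c * ((ρ ε ^ N)⁻¹ * (ρ ε ^ R)⁻¹ * (ρ ε ^ D)⁻¹) * ρ ε ^ (N + R + D + q + 1) := by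
        gcongr
    _ = c * ρ ε ^ (q + 1) := by
        rw [show N + R + D + q + 1 = N + R + D + (q + 1) by ring, pow_add, pow_add, pow_add]
        field_simp
    _ ≤ ρ ε ^ q := h6

end RobinsonColombeau

open RobinsonColombeau in
theorem mainTheorem1 (ρ : Gauge) (n : ℕ) (k : RC ρ ℝ) (hk : 0 < k) (hk_inf : k.IsInfinite)
    (X : Set (Pt ρ n)) (hKX : cube n k ⊆ X) (f : Pt ρ n → RC ρ ℂ) (hf : IsGSF X f)
    (y : Pt ρ n) (hy : y ∈ sharpInterior (cube n k)) :
    SharpLimAtTop (fun h => invHft h (hft k f) y) (f y) ∧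
      SharpLimAtTop (fun h => hft h (invHft k f) y) (f y) := by
  obtain ⟨Ω, F, hΩ, hFs, hXΩ, hFf, hmod⟩ := hf
  have hr := k.represents_rep
  have hr0 : ∀ᶠ ε in atBot, 0 ≤ k.rep ε := by
    obtain ⟨N, hN⟩ := (lt_iff_of_represents represents_zero hr).1 hk
    filter_upwards [hN] with ε h
    linarith [pow_pos (ρ.pos ε) N]
  have hF : RepresentsIntegrable (cube n k) f F :=
    ⟨Ω, hΩ, fun ε => (hFs ε).continuousOn, hKX.trans hXΩ, fun x hx => hFf x (hKX hx)⟩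
  have hyK : y ∈ cube n k := @interior_subset _ (sharpTopology ρ n) _ _ hy
  have hfy := hFf y (hKX hyK) _ y.representsPt_rep
  -- beyond `dρ^{-(S + 1)}` the truncation parameter dominates `ρ_ε^{-S}`
  have hlarge : ∀ S : ℕ, ∃ hbar : RC ρ ℝ, ∀ h : RC ρ ℝ, hbar ≤ h →
      ∀ᶠ ε in atBot, (ρ ε ^ S)⁻¹ ≤ h.rep ε := fun S => by
    have hm : Moderate ρ fun ε => (ρ ε ^ (S + 1))⁻¹ :=
      ⟨S + 1, Eventually.of_forall fun ε => by
        rw [Real.norm_of_nonneg (inv_pos.2 (pow_pos (ρ.pos ε) _)).le]⟩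
    refine ⟨RC.ofNet ρ fun ε => (ρ ε ^ (S + 1))⁻¹, fun h hh => ?_⟩
    filter_upwards [(le_iff_of_represents (Represents.ofNet hm) h.represents_rep).1 hh 0,
      ρ.eventually_le_inv_pow 2] with ε h1 h2
    rw [pow_succ, mul_inv, pow_zero] at h1
    rw [pow_one] at h2
    have h3 : 1 ≤ (ρ ε ^ S)⁻¹ :=
      (one_le_inv₀ (pow_pos (ρ.pos ε) S)).2 (pow_le_one₀ (ρ.pos ε).le (ρ.le_one ε))
    nlinarith
  have key := exists_eventually_norm_boxFourier_boxFourier_sub_le hr hr0 hΩ hFs (hKX.trans hXΩ)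
    (fun x hx => hmod x (hKX hx)) hy y.representsPt_rep
  constructor <;> intro q <;> obtain ⟨S, hS⟩ := key q <;> obtain ⟨hbar, hb⟩ := hlarge S <;>
    refine ⟨hbar, fun h hh => ?_⟩
  all_goals
    have hs0 : ∀ᶠ ε in atBot, 0 ≤ h.rep ε := (hb h hh).mono fun ε hε =>
      (inv_pos.2 (pow_pos (ρ.pos ε) S)).le.trans hε
  · exact abs_sub_le_d_pow (represents_invHft_hft hr hr0 h.represents_rep hs0 hF
      y.representsPt_rep) hfy (hS _ (hb h hh) 1 (Or.inl rfl))
  · have := hS _ (hb h hh) (-1) (Or.inr rfl)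
    rw [neg_neg] at this
    exact abs_sub_le_d_pow (represents_hft_invHft hr hr0 h.represents_rep hs0 hF
      y.representsPt_rep) hfy this
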